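/- Let $(\Omega,\mathcal F,\mathbb P)$ be an atomless probability space and $p\in(0,1)$. For a random variable $Y$ let $\mathrm{VaR}_q(Y)=\inf\{x\in\mathbb R:\mathbb P(Y\le x)\ge q\}$ and $\mathrm{ES}_p(Y)=\frac1{1-p}\int_p^1\mathrm{VaR}_q(Y)\,\mathrm dq\in(-\infty,\infty]$. **Robustness.** Let $\mathcal G$ be a set of measurable functions $g:\mathbb R\to\mathbb R$, let $\mathcal Z$ be a set of random variables with a pseudo-metric $\pi$, and let $X\in\mathcal Z$. A functional $\rho$ is *robust at $X$ relative to $(\mathcal G,\mathcal Z,\pi)$* if (1) $\rho(g(Z))\in\mathbb R\cup\{+\infty\}$ for all $g\in\mathcal G$, $Z\in\mathcal Z$, and $\rho(g(Y))=\rho(g(Z))$ whenever $g\in\mathcal G$, $Y,Z\in\mathcal Z$ and $\pi(Y,Z)=0$; and (2) there is a $g_X\in\mathcal G$ with $\rho(g_X(X))=\inf_{g\in\mathcal G}\rho(g(X))$ such that $Z\mapsto\rho(g_X(Z))$ is $\pi$-continuous at $Z=X$. We say that such a $g_X$ *witnesses* robustness. **Spaces of models.** The classic choices of $(\mathcal Z,\pi)$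 are $L^q$ with $\pi(Y,Z)=\|Y-Z\|_q$ for $q\in[1,\infty]$, and the set $L^0$ of all random variables with $\pi(Y,Z)$ the Prokhorov distance of the laws of $Y$ and $Z$. **Assumptions.** Let $X\ge0$ a.s. have a law with a Lebesgue density that is positive on the support of the law. Let $\gamma:\mathbb R\to\mathbb R$ be measurable, and continuous and strictly positive on $(0,\infty)$, with $\mathbb E[\gamma(X)]=1$ and $\mathbb E[\gamma(X)X]<\infty$. For $x_0\in\mathbb R$ and $m>0$ let $\mathcal G_{\rm cm}$ be the set of measurable $g:\mathbb R\to\mathbb R$ with $\mathbb E[\gamma(X)g(X)]\ge x_0$ (the expectation has to exist in $(-\infty,+\infty]$), and let $$\mathcal G_{\rm ns}=\{g\in\mathcal G_{\rm cm}:0\le g(X)\le X\text{ a.s.}\},\qquad \mathcal G_{\rm bd}=\{g\in\mathcal G_{\rm cm}:0\le g(X)\le m\text{ a.s.}\}.$$ Assumption E1: $\operatorname{ess\,sup}\gamma(X)\le\frac1{1-p}$. Assumption E2: $\gamma(X)$ is a.s. constant, or the distribution function of $\gamma(X)$ is continuous. **Theorem.** (i) Under E1, for every $x_0\in\mathbb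 R$ and every classic choice of $(\mathcal Z,\pi)$ with $X\in\mathcal Z$, $\mathrm{ES}_p$ is robust at $X$ relative to $(\mathcal G_{\rm cm},\mathcal Z,\pi)$, and the constant function $g_X\equiv x_0$ witnesses it. (ii) Under E2, if $0\le x_0<\mathbb E[\gamma(X)X]$ and $X\in L^q$, $q\in[1,\infty]$, then $\mathrm{ES}_p$ is robust at $X$ relative to $(\mathcal G_{\rm ns},L^q,\|\cdot\|_q)$. It is witnessed, for some constants $c>0$, $r\ge0$, $\lambda\in[0,1]$, by $$g_X(x)=x\mathbf 1_{\{\gamma(x)>c\}}+(x\wedge r)\mathbf 1_{\{\gamma(x)<c\}}+\big((1-\lambda)x+\lambda(x\wedge r)\big)\mathbf 1_{\{\gamma(x)=c\}},$$ or, if $x_0=0$, by such a function or by $g_X\equiv0$. (iii) Under E2, if $m>0$ and $0\le x_0<m$, then for every classic choice of $(\mathcal Z,\pi)$ with $X\in\mathcal Z$, $\mathrm{ES}_p$ is robust at $X$ relative to $(\mathcal G_{\rm bd},\mathcal Z,\pi)$. It is witnessed, for some constants $c>0$, $r\in[0,m]$, $\lambda\in[r,m]$, by $$g_X(x)=m\mathbf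 1_{\{\gamma(x)>c\}}+r\mathbf 1_{\{\gamma(x)<c\}}+\lambda\mathbf 1_{\{\gamma(x)=c\}},$$ or, if $x_0=0$, by such a function or by $g_X\equiv0$. -/

import Mathlib

open MeasureTheory
open scoped ENNReal Topology

namespace RobustOpt

noncomputable section

/-- The expectation of a real random variable in the extended sense, `E[Y⁺] - E[Y⁻]`.
In `EReal` one has `⊤ - ⊤ = ⊥`, so an inequality `x ≤ extExpectation μ Y` with `x` real holds
if and only if `E[Y⁻] < ∞` and the (possibly infinite) expectation of `Y` is at least `x`. -/
def extExpectation {Ω : Type*} [MeasurableSpace Ω] (μ : Measure Ω) (Y : Ω → ℝ) : EReal :=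
  ((∫⁻ ω, ENNReal.ofReal (Y ω) ∂μ : ℝ≥0∞) : EReal)
    - ((∫⁻ ω, ENNReal.ofReal (-(Y ω)) ∂μ : ℝ≥0∞) : EReal)

/-- Value-at-Risk: `VaR_p(Y) = inf {x | P(Y ≤ x) ≥ p}`. -/
def VaR {Ω : Type*} [MeasurableSpace Ω] (μ : Measure Ω) (p : ℝ) (Y : Ω → ℝ) : ℝ :=
  sInf {x : ℝ | p ≤ μ.real {ω | Y ω ≤ x}}

/-- Expected Shortfall: `ES_p(Y) = (1 - p)⁻¹ ∫_p^1 VaR_q(Y) dq`, with values in `(-∞, ∞]`. -/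
def ES {Ω : Type*} [MeasurableSpace Ω] (μ : Measure Ω) (p : ℝ) (Y : Ω → ℝ) : EReal :=
  ((1 / (1 - p) : ℝ) : EReal)
    * extExpectation (volume.restrict (Set.Ioo p 1)) (fun q => VaR μ q Y)

/-- A set of random elements of `E` on `Ω` together with a pseudo-metric on it. -/
structure ModelSpace (Ω E : Type*) [MeasurableSpace Ω] [MeasurableSpace E] where
  /-- the set of possible economic vectors -/
  carrier : Set (Ω → E)
  /-- its elements are random elements -/
  measurable_of_mem : ∀ Z ∈ carrier, Measurable Z
  /-- the pseudo-metric `π` -/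
  pseudoMetric : PseudoMetricSpace carrier

/-- An uncertainty triplet `(𝒢, 𝒵, π)`. -/
structure UncertaintyTriplet (Ω E : Type*) [MeasurableSpace Ω] [MeasurableSpace E] where
  /-- the admissible set `𝒢` of measurable functions -/
  admissible : Set (E → ℝ)
  /-- admissible functions are measurable -/
  measurable_of_mem : ∀ g ∈ admissible, Measurable g
  /-- the pseudo-metric space `(𝒵, π)` of possible models -/
  models : ModelSpace Ω E

section General

variable {Ω E : Type*} [MeasurableSpace Ω] [MeasurableSpace E]

/-- The objective functional `ρ` is compatible with the triplet: it maps `𝒢(𝒵)` to `ℝ ∪ {+∞}`,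
and it does not distinguish `g(Y)` from `g(Z)` when `π(Y, Z) = 0`. -/
def IsCompatible (ρ : (Ω → ℝ) → EReal) (T : UncertaintyTriplet Ω E) : Prop :=
  (∀ g ∈ T.admissible, ∀ Z ∈ T.models.carrier, ρ (fun ω => g (Z ω)) ≠ ⊥) ∧
  (∀ g ∈ T.admissible, ∀ Y Z : T.models.carrier, T.models.pseudoMetric.dist Y Z = 0 →
    ρ (fun ω => g (Y.1 ω)) = ρ (fun ω => g (Z.1 ω)))

/-- The set `𝒢_X(ρ)` of optimizing functions: those `g ∈ 𝒢` with
`ρ(g(X)) = inf {ρ(h(X)) | h ∈ 𝒢}`. -/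
def optimizers (ρ : (Ω → ℝ) → EReal) (G : Set (E → ℝ)) (X : Ω → E) : Set (E → ℝ) :=
  {g | g ∈ G ∧ ρ (fun ω => g (X ω)) = ⨅ h ∈ G, ρ (fun ω => h (X ω))}

/-- `g` is an optimizing function for `X` and `Z ↦ ρ(g(Z))` is `π`-continuous at `Z = X`. -/
def IsRobustOptimizer (ρ : (Ω → ℝ) → EReal) (T : UncertaintyTriplet Ω E)
    (X : T.models.carrier) (g : E → ℝ) : Prop :=
  letI : PseudoMetricSpace T.models.carrier := T.models.pseudoMetric
  g ∈ optimizers ρ T.admissible X.1 ∧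
    ContinuousAt (fun Z : T.models.carrier => ρ (fun ω => g (Z.1 ω))) X

/-- The functional `ρ` is robust (in optimization) at `X ∈ 𝒵` relative to `(𝒢, 𝒵, π)`. -/
def IsRobustAt (ρ : (Ω → ℝ) → EReal) (T : UncertaintyTriplet Ω E)
    (X : T.models.carrier) : Prop :=
  IsCompatible ρ T ∧ ∃ g : E → ℝ, IsRobustOptimizer ρ T X g

end General

section Models

variable {Ω : Type*} [MeasurableSpace Ω]

/-- The space `(L^q, π_1^q)`, `q ∈ [1, ∞]`, with `π_1^q(Y, Z) = ‖Y - Z‖_q`. -/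
def lpModels (μ : Measure Ω) (q : ℝ≥0∞) (hq : 1 ≤ q) : ModelSpace Ω ℝ where
  carrier := {Z | Measurable Z ∧ MemLp Z q μ}
  measurable_of_mem := fun _ hZ => hZ.1
  pseudoMetric :=
    { dist := fun Y Z => (eLpNorm (Y.1 - Z.1) q μ).toReal
      dist_self := fun Y => by simp
      dist_comm := fun Y Z => by simp only [eLpNorm_sub_comm Y.1 Z.1]
      dist_triangle := fun X Y Z => by
        have h1 := X.2.2.sub Y.2.2
        have h2 := Y.2.2.sub Z.2.2
        have h : X.1 - Z.1 = (X.1 - Y.1) + (Y.1 - Z.1) := by abel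
        rw [h, ← ENNReal.toReal_add h1.2.ne h2.2.ne]
        exact ENNReal.toReal_mono (ENNReal.add_ne_top.2 ⟨h1.2.ne, h2.2.ne⟩)
          (eLpNorm_add_le h1.1 h2.1 hq) }

/-- The space `(L^0, π_1^W)`: all real random variables, with the Prokhorov distance of laws. -/
def weakModels (μ : Measure Ω) [IsProbabilityMeasure μ] : ModelSpace Ω ℝ where
  carrier := {Z | Measurable Z}
  measurable_of_mem := fun _ hZ => hZ
  pseudoMetric :=
    { dist := fun Y Z => levyProkhorovDist (μ.map Y.1) (μ.map Z.1)
      dist_self := fun Y => levyProkhorovDist_self _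
      dist_comm := fun Y Z => levyProkhorovDist_comm _ _
      dist_triangle := fun X Y Z => by
        have := Measure.isProbabilityMeasure_map (μ := μ) (f := X.1)
          (Measurable.aemeasurable X.2)
        have := Measure.isProbabilityMeasure_map (μ := μ) (f := Y.1)
          (Measurable.aemeasurable Y.2)
        have := Measure.isProbabilityMeasure_map (μ := μ) (f := Z.1)
          (Measurable.aemeasurable Z.2)
        exact levyProkhorovDist_triangle _ _ _ }

/-- The classic choices of `(𝒵, π)`: `(L^q, π_1^q)` with `q ∈ [1, ∞]`, and `(L^0, π_1^W)`. -/
def IsClassicModels (μ : Measure Ω) [IsProbabilityMeasure μ] (M : ModelSpace Ω ℝ) : Prop :=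
  (∃ (q : ℝ≥0∞) (hq : 1 ≤ q), M = lpModels μ q hq) ∨ M = weakModels μ

end Models

section Problems

variable {Ω : Type*} [MeasurableSpace Ω]

/-- The global assumptions on the loss `X` and the pricing density `γ = γ(X)`. Here `γ` is
required to be continuous and positive on `(0, ∞)`, where `X` takes its values almost surely. -/
structure GlobalAssumptions (μ : Measure Ω) (X : Ω → ℝ) (γ : ℝ → ℝ) : Prop where
  measurable_X : Measurable X
  nonneg_X : ∀ᵐ ω ∂μ, 0 ≤ X ω
  /-- the law of `X` has a density that is positive on the support of that law -/
  density_X : ∃ f : ℝ → ℝ≥0∞, Measurable f ∧ μ.map X = volume.withDensity f ∧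
    ∀ x ∈ (μ.map X).support, 0 < f x
  measurable_γ : Measurable γ
  continuousOn_γ : ContinuousOn γ (Set.Ioi 0)
  pos_γ : ∀ x ∈ Set.Ioi (0 : ℝ), 0 < γ x
  integral_γ : ∫ ω, γ (X ω) ∂μ = 1
  integrable_γ_mul : Integrable (fun ω => γ (X ω) * X ω) μ

/-- The budget constraint `E[γ g(X)] ≥ x₀`. -/
def BudgetConstraint (μ : Measure Ω) (X : Ω → ℝ) (γ : ℝ → ℝ) (x₀ : ℝ) (g : ℝ → ℝ) : Prop :=
  (x₀ : EReal) ≤ extExpectation μ (fun ω => γ (X ω) * g (X ω))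

/-- `𝒢_cm` (complete market), with the space `M` of alternative models. -/
def cmTriplet (μ : Measure Ω) (X : Ω → ℝ) (γ : ℝ → ℝ) (x₀ : ℝ) (M : ModelSpace Ω ℝ) :
    UncertaintyTriplet Ω ℝ where
  admissible := {g | Measurable g ∧ BudgetConstraint μ X γ x₀ g}
  measurable_of_mem := fun _ hg => hg.1
  models := M

/-- `𝒢_ns` (no short-selling or over-hedging), with the space `M` of alternative models. -/
def nsTriplet (μ : Measure Ω) (X : Ω → ℝ) (γ : ℝ → ℝ) (x₀ : ℝ) (M : ModelSpace Ω ℝ) :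
    UncertaintyTriplet Ω ℝ where
  admissible := {g | Measurable g ∧ BudgetConstraint μ X γ x₀ g ∧
    ∀ᵐ ω ∂μ, 0 ≤ g (X ω) ∧ g (X ω) ≤ X ω}
  measurable_of_mem := fun _ hg => hg.1
  models := M

/-- `𝒢_bd` (bounded positions), with the space `M` of alternative models. -/
def bdTriplet (μ : Measure Ω) (X : Ω → ℝ) (γ : ℝ → ℝ) (x₀ m : ℝ) (M : ModelSpace Ω ℝ) :
    UncertaintyTriplet Ω ℝ where
  admissible := {g | Measurable g ∧ BudgetConstraint μ X γ x₀ g ∧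
    ∀ᵐ ω ∂μ, 0 ≤ g (X ω) ∧ g (X ω) ≤ m}
  measurable_of_mem := fun _ hg => hg.1
  models := M

/-- `ess-sup γ(X) ≤ 1 / (1 - p)`; the essential supremum is taken in `[-∞, ∞]`. -/
def AssumptionE1 (μ : Measure Ω) (X : Ω → ℝ) (γ : ℝ → ℝ) (p : ℝ) : Prop :=
  essSup (fun ω => (γ (X ω) : EReal)) μ ≤ ((1 / (1 - p) : ℝ) : EReal)

/-- Either `γ(X)` is a constant, or `γ(X)` is continuously distributed. -/
def AssumptionE2 (μ : Measure Ω) (X : Ω → ℝ) (γ : ℝ → ℝ) : Prop :=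
  (∃ k : ℝ, ∀ᵐ ω ∂μ, γ (X ω) = k) ∨ (∀ k : ℝ, μ {ω | γ (X ω) = k} = 0)

/-- `x 1_{γ(x) > c} + (x ∧ r) 1_{γ(x) < c} + ((1 - lam) x + lam (x ∧ r)) 1_{γ(x) = c}`. -/
def nsPosition (γ : ℝ → ℝ) (c r lam : ℝ) (x : ℝ) : ℝ :=
  if c < γ x then x else if γ x < c then min x r else (1 - lam) * x + lam * min x r

/-- `m 1_{γ(x) > c} + r 1_{γ(x) < c} + lam 1_{γ(x) = c}`. -/
def bdPosition (γ : ℝ → ℝ) (m c r lam : ℝ) (x : ℝ) : ℝ :=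
  if c < γ x then m else if γ x < c then r else lam

end Problems

end

end RobustOpt

/-! Everything rests on the Rockafellar-Uryasev formula: `ES` is the minimum over `t` of `t + E[(Y -
t)⁺] / (1 - p)`, attained at `VaR` (`ES_of_integrable_excess`, `ruObjective_VaR_le`). Any `t` gives
an upper bound. Dually, scenarios `0 ≤ w ≤ 1` with `E[w] ≤ 1 - p` give lower bounds `E[wY] / (1 -
p)` for `Y ≥ 0`.

In the complete market, E1 says that `γ(X)` is itself an admissible density for the dual bound. So
every position of price at least `x₀` has `ES ≥ x₀`, and the constant `x₀`, trivially continuous,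
attains it.

For the constrained problems put `ξ = γ(X)` and let `U` be the upper limit, `X` or `m`. If `ξ` is
atomless, the candidate is `G = U` on `{ξ > c}` and `U ∧ r` elsewhere, with dual scenario `w = (1 ∧
ξ/c) 1_{U > r}`. Complementary slackness (`excess_hedge`, `slack_hedge`) yields `ES(G) ≤ E[wG]/(1-p)
≤ E[wY]/(1-p) ≤ ES(Y)` for every competitor `Y`, once `G` costs exactly `x₀` and `E[w] = 1 - p`, or
`E[w] ≤ 1 - p` with `r = 0` (`ES_hedge_le`). Such `c, r` come from an extremal argument in two
variables: take the largest `r` for which both defects can be nonnegative and cross them by the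
intermediate value theorem (`exists_complementary_pair`). If `γ(X)` is constant it equals `1`, the
budget is a plain mean, and `X ∧ r` or the constant `x₀` is optimal. For `x₀ = 0` the zero position
is optimal.

For continuity, the optimal position can jump on `(0, ∞)` only where `γ = c`, a null event for `X`.
For `0 ≤ g(X) ≤ X` linear growth and `L¹` convergence suffice; for bounded positions there are only
three values, so weak convergence and null frontiers do. -/

namespace RobustOpt

/-! ### Quantiles, the Rockafellar-Uryasev formula and dual bounds for Expected Shortfall -/

section ShortfallTheory

variable {Ω : Type*} [MeasurableSpace Ω] {μ : Measure Ω} [IsProbabilityMeasure μ]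
  {Y Z : Ω → ℝ} {p q t : ℝ}

lemma VaR_eq_cdf (hY : Measurable Y) (q : ℝ) :
    VaR μ q Y = sInf {x : ℝ | q ≤ ProbabilityTheory.cdf (μ.map Y) x} := by
  have := Measure.isProbabilityMeasure_map (μ := μ) hY.aemeasurable
  unfold VaR
  congr 1
  ext x
  rw [Set.mem_ofPred_eq, Set.mem_ofPred_eq, ProbabilityTheory.cdf_eq_real,
    map_measureReal_apply hY measurableSet_Iic]
  rfl

/-- Right continuity of the distribution function makes the infimum attained; this Galois connection
drives all quantile facts. -/
lemma VaR_le_iff_cdf (hY : Measurable Y) (hq : q ∈ Set.Ioo (0 : ℝ) 1) (x : ℝ) :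
    VaR μ q Y ≤ x ↔ q ≤ ProbabilityTheory.cdf (μ.map Y) x := by
  set F := ProbabilityTheory.cdf (μ.map Y) with hF
  rw [VaR_eq_cdf hY]
  have hbdd : BddBelow {x : ℝ | q ≤ F x} := by
    obtain ⟨a, ha⟩ := ((ProbabilityTheory.tendsto_cdf_atBot (μ.map Y)).eventually_lt_const
      hq.1).exists
    refine ⟨a, fun y hy => le_of_not_gt fun h => ?_⟩
    exact absurd (hy.trans (F.mono h.le)) (not_le.2 ha)
  have hne : {x : ℝ | q ≤ F x}.Nonempty := by
    obtain ⟨a, ha⟩ := ((ProbabilityTheory.tendsto_cdf_atTop (μ.map Y)).eventually_const_lt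
      hq.2).exists
    exact ⟨a, ha.le⟩
  refine ⟨fun h => ?_, fun h => csInf_le hbdd h⟩
  have hright : Filter.Tendsto F (𝓝[>] x) (𝓝 (F x)) :=
    (F.right_continuous x).mono_left (nhdsWithin_mono _ Set.Ioi_subset_Ici_self)
  refine ge_of_tendsto hright ?_
  filter_upwards [self_mem_nhdsWithin] with y hy
  obtain ⟨z, hz, hzy⟩ := exists_lt_of_csInf_lt hne (lt_of_le_of_lt h hy)
  exact le_trans hz (F.mono hzy.le)

lemma VaR_mono (hY : Measurable Y) {q₁ q₂ : ℝ} (h₁ : q₁ ∈ Set.Ioo (0 : ℝ) 1)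
    (h₂ : q₂ ∈ Set.Ioo (0 : ℝ) 1) (h : q₁ ≤ q₂) : VaR μ q₁ Y ≤ VaR μ q₂ Y := by
  rw [VaR_le_iff_cdf hY h₁]
  exact h.trans ((VaR_le_iff_cdf hY h₂ _).1 le_rfl)

lemma VaR_nonneg {ν : Measure Ω} (hY : ∀ᵐ ω ∂ν, 0 ≤ Y ω) (hq : 0 < q) : 0 ≤ VaR ν q Y := by
  refine Real.sInf_nonneg fun x hx => ?_
  by_contra! h
  have h0 : ν {ω | Y ω ≤ x} = 0 := by
    refine measure_mono_null (fun ω hω => ?_) hY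
    simp only [Set.mem_ofPred_eq, Set.mem_compl_iff] at hω ⊢
    linarith
  have : q ≤ 0 := by simpa [measureReal_def, h0] using hx
  linarith

lemma VaR_le_of_ae_le (hY : Measurable Y) (hq : q ∈ Set.Ioo (0 : ℝ) 1) {m : ℝ}
    (h : ∀ᵐ ω ∂μ, Y ω ≤ m) : VaR μ q Y ≤ m := by
  have := Measure.isProbabilityMeasure_map (μ := μ) hY.aemeasurable
  rw [VaR_le_iff_cdf hY hq, ProbabilityTheory.cdf_eq_real,
    map_measureReal_apply hY measurableSet_Iic]
  have h1 : μ (Y ⁻¹' Set.Iic m) = 1 := (prob_compl_eq_zero_iff (hY measurableSet_Iic)).1 h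
  simp [measureReal_def, h1, hq.2.le]

lemma VaR_congr_map (hY : Measurable Y) (hZ : Measurable Z) (h : μ.map Y = μ.map Z) :
    VaR μ q Y = VaR μ q Z := by
  rw [VaR_eq_cdf hY, VaR_eq_cdf hZ, h]

lemma ES_congr_map (hY : Measurable Y) (hZ : Measurable Z) (h : μ.map Y = μ.map Z) :
    ES μ p Y = ES μ p Z := by
  unfold ES
  simp only [VaR_congr_map hY hZ h]

lemma aemeasurable_VaR (hY : Measurable Y) :
    AEMeasurable (fun q => VaR μ q Y) (volume.restrict (Set.Ioo (0 : ℝ) 1)) := by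
  refine aemeasurable_restrict_of_monotoneOn measurableSet_Ioo fun a ha b hb hab =>
    VaR_mono hY ha hb hab

/-- The quantile transform. -/
lemma map_VaR (hY : Measurable Y) :
    (volume.restrict (Set.Ioo (0 : ℝ) 1)).map (fun q => VaR μ q Y) = μ.map Y := by
  have := Measure.isProbabilityMeasure_map (μ := μ) hY.aemeasurable
  have hfin : IsFiniteMeasure (volume.restrict (Set.Ioo (0 : ℝ) 1)) := inferInstance
  refine Measure.ext_of_Iic _ _ fun x => ?_
  rw [Measure.map_apply_of_aemeasurable (aemeasurable_VaR hY) measurableSet_Iic,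
    ← ProbabilityTheory.ofReal_cdf, Measure.restrict_apply' measurableSet_Ioo]
  have h0 := ProbabilityTheory.cdf_nonneg (μ.map Y) x
  have h1 := ProbabilityTheory.cdf_le_one (μ.map Y) x
  have : (fun q => VaR μ q Y) ⁻¹' Set.Iic x ∩ Set.Ioo 0 1
      = Set.Iic (ProbabilityTheory.cdf (μ.map Y) x) ∩ Set.Ioo 0 1 := by
    ext q
    simp only [Set.mem_inter_iff, Set.mem_preimage, Set.mem_Iic, and_congr_left_iff]
    exact fun hq => VaR_le_iff_cdf hY hq x
  rw [this, ← Measure.restrict_apply measurableSet_Iic, restrict_Ioo_eq_restrict_Ioc,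
    Measure.restrict_apply measurableSet_Iic, Set.inter_comm, Set.Ioc_inter_Iic,
    min_eq_right h1, Real.volume_Ioc, sub_zero]

lemma extExpectation_eq_integral {f : Ω → ℝ} {ν : Measure Ω} (hf : Integrable f ν) :
    extExpectation ν f = ((∫ ω, f ω ∂ν : ℝ) : EReal) := by
  have h1 : ∫⁻ ω, ENNReal.ofReal (f ω) ∂ν ≠ ⊤ := hf.lintegral_lt_top.ne
  have h2 : ∫⁻ ω, ENNReal.ofReal (-f ω) ∂ν ≠ ⊤ := hf.neg.lintegral_lt_top.ne
  rw [integral_eq_lintegral_pos_part_sub_lintegral_neg_part hf, extExpectation, EReal.coe_sub,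
    EReal.coe_ennreal_toReal h1, EReal.coe_ennreal_toReal h2]

lemma extExpectation_mono {f g : Ω → ℝ} {ν : Measure Ω} (h : ∀ᵐ ω ∂ν, f ω ≤ g ω) :
    extExpectation ν f ≤ extExpectation ν g := by
  refine EReal.sub_le_sub ?_ ?_
  · exact EReal.coe_ennreal_le_coe_ennreal_iff.2 (lintegral_mono_ae (h.mono fun ω hω =>
      ENNReal.ofReal_le_ofReal hω))
  · exact EReal.coe_ennreal_le_coe_ennreal_iff.2 (lintegral_mono_ae (h.mono fun ω hω =>
      ENNReal.ofReal_le_ofReal (neg_le_neg hω)))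

lemma extExpectation_eq_top {f : Ω → ℝ} {ν : Measure Ω} [IsFiniteMeasure ν]
    (hm : AEMeasurable f ν) (hb : ∀ᵐ ω ∂ν, t ≤ f ω) (hf : ¬ Integrable f ν) :
    extExpectation ν f = ⊤ := by
  have h2 : ∫⁻ ω, ENNReal.ofReal (-f ω) ∂ν ≠ ⊤ := by
    refine ne_of_lt (lt_of_le_of_lt (lintegral_mono_ae (g := fun _ => ENNReal.ofReal (-t))
      (hb.mono fun ω hω => ENNReal.ofReal_le_ofReal (neg_le_neg hω))) ?_)
    simp [lintegral_const, ENNReal.mul_lt_top_iff, measure_lt_top]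
  have h1 : ∫⁻ ω, ENNReal.ofReal (f ω) ∂ν = ⊤ := by
    by_contra h
    refine hf ⟨hm.aestronglyMeasurable, ?_⟩
    rw [hasFiniteIntegral_iff_norm]
    have : ∀ ω, ENNReal.ofReal ‖f ω‖ = ENNReal.ofReal (f ω) + ENNReal.ofReal (-f ω) := by
      intro ω
      rw [Real.norm_eq_abs]
      rcases le_total 0 (f ω) with h | h
      · rw [abs_of_nonneg h, ENNReal.ofReal_of_nonpos (neg_nonpos.2 h), add_zero]
      · rw [abs_of_nonpos h, ENNReal.ofReal_of_nonpos h, zero_add]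
    simp only [this]
    rw [lintegral_add_left' hm.ennreal_ofReal]
    exact ENNReal.add_lt_top.2 ⟨lt_top_iff_ne_top.2 h, lt_top_iff_ne_top.2 h2⟩
  rw [extExpectation, h1, EReal.coe_ennreal_top, ← EReal.coe_ennreal_toReal h2,
    EReal.top_sub_coe]

/-- The Rockafellar-Uryasev objective `t + (1 - p)⁻¹ E[(Y - t)⁺]`. -/
noncomputable def ruObjective (μ : Measure Ω) (p : ℝ) (Y : Ω → ℝ) (t : ℝ) : ℝ :=
  t + 1 / (1 - p) * ∫ ω, max (Y ω - t) 0 ∂μ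

lemma integral_excess_eq (hY : Measurable Y) (t : ℝ) :
    ∫ ω, max (Y ω - t) 0 ∂μ = ∫ q in Set.Ioo (0 : ℝ) 1, max (VaR μ q Y - t) 0 := by
  rw [← integral_map (μ := μ) (f := fun y => max (y - t) 0) hY.aemeasurable
    (by fun_prop), ← map_VaR hY, integral_map (aemeasurable_VaR hY) (by fun_prop)]

lemma integrable_excess_iff (hY : Measurable Y) (t : ℝ) :
    Integrable (fun ω => max (Y ω - t) 0) μ ↔
      IntegrableOn (fun q => max (VaR μ q Y - t) 0) (Set.Ioo 0 1) := by
  rw [show (fun ω => max (Y ω - t) 0) = (fun y => max (y - t) 0) ∘ Y from rfl,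
    ← integrable_map_measure (by fun_prop) hY.aemeasurable, ← map_VaR hY,
    integrable_map_measure (by fun_prop) (aemeasurable_VaR hY)]
  rfl

/-- Quantiles increase in the level, so at threshold `VaR μ p Y` the positive part cuts exactly at
`q = p`. This turns the tail integral in `ES` into an expected excess. -/
lemma excess_VaR_eq_indicator (hY : Measurable Y) (hp : p ∈ Set.Ioo (0 : ℝ) 1) :
    Set.EqOn (fun q => max (VaR μ q Y - VaR μ p Y) 0)
      ((Set.Ioo p 1).indicator fun q => VaR μ q Y - VaR μ p Y) (Set.Ioo 0 1) := by
  intro q hq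
  by_cases h : p < q
  · rw [Set.indicator_of_mem (show q ∈ Set.Ioo p 1 from ⟨h, hq.2⟩)]
    exact max_eq_left (sub_nonneg.2 (VaR_mono hY hp hq h.le))
  · rw [Set.indicator_of_notMem (fun h' => h h'.1)]
    exact max_eq_right (sub_nonpos.2 (VaR_mono hY hq hp (not_lt.1 h)))

lemma integrableOn_VaR_iff (hY : Measurable Y) (hp : p ∈ Set.Ioo (0 : ℝ) 1) :
    IntegrableOn (fun q => VaR μ q Y) (Set.Ioo p 1) ↔
      Integrable (fun ω => max (Y ω - VaR μ p Y) 0) μ := by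
  have hsub : Set.Ioo p 1 ⊆ Set.Ioo (0 : ℝ) 1 := Set.Ioo_subset_Ioo_left hp.1.le
  rw [integrable_excess_iff hY, integrableOn_congr_fun (excess_VaR_eq_indicator hY hp)
    measurableSet_Ioo, IntegrableOn, IntegrableOn, integrable_indicator_iff measurableSet_Ioo,
    IntegrableOn, Measure.restrict_restrict measurableSet_Ioo, Set.inter_eq_left.2 hsub]
  refine ⟨fun h => h.sub (integrable_const _), fun h => ?_⟩
  exact (h.add (integrable_const (VaR μ p Y))).congr (ae_of_all _ fun q => sub_add_cancel _ _)

/-- Only the upper tail has to be integrable: in the complete market the competitors may have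
arbitrary lower tails. -/
lemma ES_of_integrable_excess (hY : Measurable Y) (hp : p ∈ Set.Ioo (0 : ℝ) 1)
    (h : Integrable (fun ω => max (Y ω - VaR μ p Y) 0) μ) :
    ES μ p Y = (ruObjective μ p Y (VaR μ p Y) : EReal) := by
  have hsub : Set.Ioo p 1 ⊆ Set.Ioo (0 : ℝ) 1 := Set.Ioo_subset_Ioo_left hp.1.le
  have hi := (integrableOn_VaR_iff hY hp).2 h
  have hp' : 0 < 1 - p := sub_pos.2 hp.2
  rw [ES, extExpectation_eq_integral hi, ← EReal.coe_mul, ruObjective, integral_excess_eq hY,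
    setIntegral_congr_fun measurableSet_Ioo (excess_VaR_eq_indicator hY hp),
    setIntegral_indicator measurableSet_Ioo, Set.inter_eq_right.2 hsub,
    integral_sub hi (integrable_const _)]
  congr 1
  simp only [integral_const, measureReal_restrict_apply_univ, Real.volume_real_Ioo_of_le hp.2.le,
    smul_eq_mul]
  field_simp
  ring

lemma ES_of_not_integrable_excess (hY : Measurable Y) (hp : p ∈ Set.Ioo (0 : ℝ) 1)
    (h : ¬ Integrable (fun ω => max (Y ω - VaR μ p Y) 0) μ) : ES μ p Y = ⊤ := by
  have hsub : Set.Ioo p 1 ⊆ Set.Ioo (0 : ℝ) 1 := Set.Ioo_subset_Ioo_left hp.1.le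
  have hp' : 0 < 1 - p := sub_pos.2 hp.2
  rw [ES, extExpectation_eq_top (t := VaR μ p Y)
    ((aemeasurable_VaR hY).mono_measure (Measure.restrict_mono hsub le_rfl))
    ((ae_restrict_mem measurableSet_Ioo).mono fun q hq => VaR_mono hY hp (hsub hq) hq.1.le)
    (fun hi => h ((integrableOn_VaR_iff hY hp).1 hi))]
  exact EReal.coe_mul_top_of_pos (by positivity)

lemma ES_ne_bot (hY : Measurable Y) (hp : p ∈ Set.Ioo (0 : ℝ) 1) : ES μ p Y ≠ ⊥ := by
  by_cases h : Integrable (fun ω => max (Y ω - VaR μ p Y) 0) μ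
  · rw [ES_of_integrable_excess hY hp h]
    exact EReal.coe_ne_bot _
  · rw [ES_of_not_integrable_excess hY hp h]
    exact top_ne_bot

lemma Integrable.excess (h : Integrable Y μ) (t : ℝ) :
    Integrable (fun ω => max (Y ω - t) 0) μ :=
  (h.sub (integrable_const t)).pos_part

lemma ES_eq_ruObjective (hY : Measurable Y) (hi : Integrable Y μ) (hp : p ∈ Set.Ioo (0 : ℝ) 1) :
    ES μ p Y = (ruObjective μ p Y (VaR μ p Y) : EReal) :=
  ES_of_integrable_excess hY hp (Integrable.excess hi _)

/-- For every `t` the excess dominates `∫_p^1 (VaR_q - t) dq`, with equality at `t = VaR_p`; in the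
objective the `t`-terms then cancel. -/
lemma ruObjective_VaR_le (hY : Measurable Y) (hi : Integrable Y μ) (hp : p ∈ Set.Ioo (0 : ℝ) 1)
    (t : ℝ) : ruObjective μ p Y (VaR μ p Y) ≤ ruObjective μ p Y t := by
  have hsub : Set.Ioo p 1 ⊆ Set.Ioo (0 : ℝ) 1 := Set.Ioo_subset_Ioo_left hp.1.le
  have hp' : 0 < 1 - p := sub_pos.2 hp.2
  have h1 := (integrable_excess_iff hY t).1 (Integrable.excess hi t)
  have hQ := (integrableOn_VaR_iff hY hp).2 (Integrable.excess hi _)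
  have key : ∫ q in Set.Ioo p 1, (VaR μ q Y - t) ≤ ∫ ω, max (Y ω - t) 0 ∂μ := by
    rw [integral_excess_eq hY]
    refine le_trans ?_ (setIntegral_mono_set h1 (ae_of_all _ fun q => le_max_right _ _)
      (Filter.Eventually.of_forall hsub))
    exact setIntegral_mono (hQ.sub (integrable_const _)) (h1.mono_set hsub)
      fun q => le_max_left _ _
  have key0 : ∫ ω, max (Y ω - VaR μ p Y) 0 ∂μ = ∫ q in Set.Ioo p 1, (VaR μ q Y - VaR μ p Y) := by
    rw [integral_excess_eq hY,
      setIntegral_congr_fun measurableSet_Ioo (excess_VaR_eq_indicator hY hp),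
      setIntegral_indicator measurableSet_Ioo, Set.inter_eq_right.2 hsub]
  have hs : ∀ s : ℝ, ∫ q in Set.Ioo p 1, (VaR μ q Y - s)
      = (∫ q in Set.Ioo p 1, VaR μ q Y) - (1 - p) * s := by
    intro s
    rw [integral_sub hQ (integrable_const _)]
    simp [Real.volume_real_Ioo_of_le hp.2.le]
  rw [hs] at key key0
  rw [ruObjective, ruObjective, key0]
  have : (1 / (1 - p)) * ((∫ q in Set.Ioo p 1, VaR μ q Y) - (1 - p) * t)
      ≤ 1 / (1 - p) * ∫ ω, max (Y ω - t) 0 ∂μ := by gcongr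
  have e : ∀ s a : ℝ, s + 1 / (1 - p) * (a - (1 - p) * s) = 1 / (1 - p) * a := by
    intro s a; field_simp; ring
  rw [e]
  have := e t (∫ q in Set.Ioo p 1, VaR μ q Y)
  linarith

lemma ES_le_ruObjective (hY : Measurable Y) (hi : Integrable Y μ) (hp : p ∈ Set.Ioo (0 : ℝ) 1)
    (t : ℝ) : ES μ p Y ≤ (ruObjective μ p Y t : EReal) := by
  rw [ES_eq_ruObjective hY hi hp]
  exact_mod_cast ruObjective_VaR_le hY hi hp t

lemma ES_const (hp : p ∈ Set.Ioo (0 : ℝ) 1) (a : ℝ) : ES μ p (fun _ => a) = (a : EReal) := by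
  have h1 : VaR μ p (fun _ => a) = a := by
    have : {x : ℝ | p ≤ μ.real {ω : Ω | a ≤ x}} = Set.Ici a := by
      ext x
      by_cases h : a ≤ x <;> simp [h, hp.2.le, hp.1]
    rw [VaR, this, csInf_Ici]
  rw [ES_eq_ruObjective measurable_const (integrable_const a) hp, h1]
  simp [ruObjective]

lemma ES_nonneg (hY : Measurable Y) (hp : p ∈ Set.Ioo (0 : ℝ) 1) (h : ∀ᵐ ω ∂μ, 0 ≤ Y ω) :
    0 ≤ ES μ p Y := by
  have hp' : 0 < 1 - p := sub_pos.2 hp.2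
  by_cases hi : Integrable (fun ω => max (Y ω - VaR μ p Y) 0) μ
  · rw [ES_of_integrable_excess hY hp hi]
    have := VaR_nonneg (q := p) h hp.1
    have h2 : 0 ≤ ∫ ω, max (Y ω - VaR μ p Y) 0 ∂μ := integral_nonneg fun _ => le_max_right _ _
    have : 0 ≤ ruObjective μ p Y (VaR μ p Y) := by unfold ruObjective; positivity
    exact_mod_cast this
  · rw [ES_of_not_integrable_excess hY hp hi]
    exact le_top

/-- A lower bound for Expected Shortfall by scenarios whose density has mass at most one. -/
lemma le_ES_of_scenario (hY : Measurable Y) (hi : Integrable Y μ) (hp : p ∈ Set.Ioo (0 : ℝ) 1)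
    (h0 : ∀ᵐ ω ∂μ, 0 ≤ Y ω) {w : Ω → ℝ} (hw : Measurable w) (hw0 : ∀ᵐ ω ∂μ, 0 ≤ w ω)
    (hw1 : ∀ᵐ ω ∂μ, w ω ≤ 1) (hmass : ∫ ω, w ω ∂μ ≤ 1 - p) :
    ((1 / (1 - p) * ∫ ω, w ω * Y ω ∂μ : ℝ) : EReal) ≤ ES μ p Y := by
  have hp' : 0 < 1 - p := sub_pos.2 hp.2
  rw [ES_eq_ruObjective hY hi hp]
  set t := VaR μ p Y
  -- Nonnegativity of the threshold is what allows scenarios of mass below `1 - p`.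
  have ht : 0 ≤ t := VaR_nonneg h0 hp.1
  have hwi : Integrable w μ := by
    refine Integrable.of_bound hw.aestronglyMeasurable 1 ?_
    filter_upwards [hw0, hw1] with ω a b
    rw [Real.norm_eq_abs, abs_of_nonneg a]; exact b
  have hwY : Integrable (fun ω => w ω * Y ω) μ := by
    refine Integrable.mono hi (hw.mul hY).aestronglyMeasurable ?_
    filter_upwards [hw0, hw1] with ω a b
    rw [norm_mul, Real.norm_eq_abs (w ω), abs_of_nonneg a]
    exact mul_le_of_le_one_left (norm_nonneg _) b
  have h1 : (∫ ω, w ω * Y ω ∂μ) - t * ∫ ω, w ω ∂μ ≤ ∫ ω, max (Y ω - t) 0 ∂μ := by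
    rw [← integral_const_mul, ← integral_sub hwY (hwi.const_mul t)]
    refine integral_mono_ae (hwY.sub (hwi.const_mul t)) (Integrable.excess hi t) ?_
    filter_upwards [hw0, hw1] with ω a b
    have h2 : w ω * (Y ω - t) ≤ w ω * max (Y ω - t) 0 :=
      mul_le_mul_of_nonneg_left (le_max_left _ _) a
    have h3 := mul_le_of_le_one_left (le_max_right (Y ω - t) 0) b
    linarith
  have h2 : (∫ ω, w ω * Y ω ∂μ) - t * (1 - p) ≤ ∫ ω, max (Y ω - t) 0 ∂μ := by
    have := mul_le_mul_of_nonneg_left hmass ht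
    linarith
  have h3 : 1 / (1 - p) * ((∫ ω, w ω * Y ω ∂μ) - t * (1 - p))
      ≤ 1 / (1 - p) * ∫ ω, max (Y ω - t) 0 ∂μ := by gcongr
  have h4 : 1 / (1 - p) * ((∫ ω, w ω * Y ω ∂μ) - t * (1 - p))
      = 1 / (1 - p) * (∫ ω, w ω * Y ω ∂μ) - t := by field_simp
  have h5 : 1 / (1 - p) * ∫ ω, w ω * Y ω ∂μ ≤ ruObjective μ p Y t := by
    unfold ruObjective; linarith
  exact_mod_cast h5

/-- A lower bound for Expected Shortfall by a pricing density bounded by `(1 - p)⁻¹`. -/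
lemma le_ES_of_density_le (hY : Measurable Y) (hp : p ∈ Set.Ioo (0 : ℝ) 1) {ξ : Ω → ℝ}
    (hξ : Integrable ξ μ) (hξ0 : ∀ᵐ ω ∂μ, 0 ≤ ξ ω) (hξ1 : ∀ᵐ ω ∂μ, ξ ω ≤ 1 / (1 - p))
    (hmass : ∫ ω, ξ ω ∂μ = 1) : extExpectation μ (fun ω => ξ ω * Y ω) ≤ ES μ p Y := by
  by_cases hi : Integrable (fun ω => max (Y ω - VaR μ p Y) 0) μ
  · rw [ES_of_integrable_excess hY hp hi]
    set t := VaR μ p Y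
    have hint : Integrable (fun ω => 1 / (1 - p) * max (Y ω - t) 0 + t * ξ ω) μ :=
      (hi.const_mul _).add (hξ.const_mul _)
    -- Pointwise weak duality. The right side is integrable, so no integrability of `ξ Y` is needed.
    have h1 : ∀ᵐ ω ∂μ, ξ ω * Y ω ≤ 1 / (1 - p) * max (Y ω - t) 0 + t * ξ ω := by
      filter_upwards [hξ0, hξ1] with ω a b
      have h2 : ξ ω * (Y ω - t) ≤ ξ ω * max (Y ω - t) 0 :=
        mul_le_mul_of_nonneg_left (le_max_left _ _) a
      have h3 := mul_le_mul_of_nonneg_right b (le_max_right (Y ω - t) 0)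
      linarith
    refine (extExpectation_mono h1).trans ?_
    rw [extExpectation_eq_integral hint, integral_add (hi.const_mul _) (hξ.const_mul _),
      integral_const_mul, integral_const_mul, hmass, mul_one, ruObjective, add_comm]
  · rw [ES_of_not_integrable_excess hY hp hi]
    exact le_top

end ShortfallTheory

/-! ### An intermediate value argument in two variables -/

/-- For `f` decreasing and `h` increasing in the first argument there is a zero of `h` at which
either `f` vanishes, or `f ≤ 0` and the second argument is minimal. -/
lemma exists_complementary_pair {R K c₀ : ℝ} {f h : ℝ × ℝ → ℝ} (hR : 0 ≤ R)
    (hf : ContinuousOn f (Set.Ioi 0 ×ˢ Set.Icc 0 R))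
    (hh : ContinuousOn h (Set.Ioi 0 ×ˢ Set.Icc 0 R))
    (f_anti : ∀ r ∈ Set.Icc 0 R, ∀ c c' : ℝ, 0 < c → c ≤ c' → f (c', r) ≤ f (c, r))
    (h_mono : ∀ r ∈ Set.Icc 0 R, ∀ c c' : ℝ, 0 < c → c ≤ c' → h (c, r) ≤ h (c', r))
    (hc₀ : 0 < c₀) (hlow : ∀ c, 0 < c → c ≤ c₀ → ∀ r ∈ Set.Icc 0 R, h (c, r) < 0)
    (hK : ∀ c, K ≤ c → ∀ r ∈ Set.Icc 0 R, f (c, r) < 0) (hlarge : ∃ c, 0 < c ∧ 0 ≤ h (c, 0))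
    (hend : ∀ c, 0 < c → ¬ (0 ≤ f (c, R) ∧ 0 ≤ h (c, R))) :
    ∃ c, 0 < c ∧ ∃ r ∈ Set.Icc 0 R, h (c, r) = 0 ∧ (f (c, r) = 0 ∨ (f (c, r) ≤ 0 ∧ r = 0)) := by
  have h0R : (0 : ℝ) ∈ Set.Icc 0 R := ⟨le_rfl, hR⟩
  have hslice : ∀ r ∈ Set.Icc 0 R, ∀ g : ℝ × ℝ → ℝ, ContinuousOn g (Set.Ioi 0 ×ˢ Set.Icc 0 R) →
      ContinuousOn (fun c => g (c, r)) (Set.Ioi 0) := fun r hr g hg =>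
    hg.comp (by fun_prop) fun c hc => ⟨hc, hr⟩
  by_cases hS : ∃ c, 0 < c ∧ 0 ≤ f (c, 0) ∧ 0 ≤ h (c, 0)
  · have mem_box : ∀ c r, 0 < c → r ∈ Set.Icc 0 R → 0 ≤ f (c, r) → 0 ≤ h (c, r) →
        c ∈ Set.Icc c₀ K := by
      intro c r hc hr h1 h2
      constructor
      · by_contra! hcc
        exact absurd h2 (not_le.2 (hlow c hc hcc.le r hr))
      · by_contra! hcc
        exact absurd h1 (not_le.2 (hK c hcc.le r hr))
    set B : Set (ℝ × ℝ) := Set.Icc c₀ K ×ˢ Set.Icc 0 R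
    have hBsub : B ⊆ Set.Ioi 0 ×ˢ Set.Icc 0 R :=
      Set.prod_mono (fun c hc => lt_of_lt_of_le hc₀ hc.1) le_rfl
    have hBc : IsCompact B := isCompact_Icc.prod isCompact_Icc
    -- The pairs with `f, h ≥ 0` lie in a compact box by `hlow` and `hK`; a pair with the largest
    -- `r` is selected.
    have hSc : IsCompact ((B ∩ f ⁻¹' Set.Ici 0) ∩ (B ∩ h ⁻¹' Set.Ici 0)) := by
      refine hBc.of_isClosed_subset (IsClosed.inter ?_ ?_) fun z hz => hz.1.1
      · exact (hf.mono hBsub).preimage_isClosed_of_isClosed hBc.isClosed isClosed_Ici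
      · exact (hh.mono hBsub).preimage_isClosed_of_isClosed hBc.isClosed isClosed_Ici
    have hSne : ((B ∩ f ⁻¹' Set.Ici 0) ∩ (B ∩ h ⁻¹' Set.Ici 0)).Nonempty := by
      obtain ⟨c, hc, h1, h2⟩ := hS
      have := mem_box c 0 hc h0R h1 h2
      exact ⟨(c, 0), ⟨⟨this, h0R⟩, h1⟩, ⟨this, h0R⟩, h2⟩
    obtain ⟨⟨c, r⟩, ⟨⟨⟨hcB, hr⟩, hfc⟩, -, hhc⟩, hmax⟩ :=
      hSc.exists_isMaxOn hSne (continuous_snd.continuousOn)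
    simp only [Set.mem_preimage, Set.mem_Ici] at hfc hhc
    have hc : 0 < c := lt_of_lt_of_le hc₀ hcB.1
    replace hr : r ∈ Set.Icc 0 R := hr
    have hfr := hslice r hr f hf
    have hhr := hslice r hr h hh
    -- If both were positive at some `c'`, continuity would keep them so for slightly larger `r`,
    -- against maximality; `hend` rules out `r = R`.
    have not_both : ∀ c', 0 < c' → ¬ (0 < f (c', r) ∧ 0 < h (c', r)) := by
      rintro c' hc' ⟨h1, h2⟩
      have hrR : r < R := lt_of_le_of_ne hr.2 fun e => hend c' hc' (e ▸ ⟨h1.le, h2.le⟩)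
      have hrow : ∀ g : ℝ × ℝ → ℝ, ContinuousOn g (Set.Ioi 0 ×ˢ Set.Icc 0 R) → 0 < g (c', r) →
          ∀ᶠ s in 𝓝[Set.Icc 0 R] r, 0 < g (c', s) := by
        intro g hg hpos
        have : ContinuousOn (fun s => g (c', s)) (Set.Icc 0 R) :=
          hg.comp (by fun_prop) fun s hs => ⟨hc', hs⟩
        exact (this r hr).eventually_const_lt hpos
      have hle : 𝓝[Set.Ioc r R] r ≤ 𝓝[Set.Icc 0 R] r :=
        nhdsWithin_mono _ fun s hs => ⟨hr.1.trans hs.1.le, hs.2⟩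
      have hne : (𝓝[Set.Ioc r R] r).NeBot := by
        rw [nhdsWithin_Ioc_eq_nhdsGT hrR]; infer_instance
      obtain ⟨s, ⟨hs1, hs2⟩, hs⟩ := ((((hrow f hf h1).and (hrow h hh h2)).filter_mono hle).and
        self_mem_nhdsWithin).exists
      have hsR : s ∈ Set.Icc 0 R := ⟨hr.1.trans hs.1.le, hs.2⟩
      have hbox := mem_box c' s hc' hsR hs1.le hs2.le
      have : s ≤ r := hmax (show (c', s) ∈ _ from ⟨⟨⟨hbox, hsR⟩, hs1.le⟩, ⟨hbox, hsR⟩, hs2.le⟩)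
      exact absurd hs.1 (not_lt.2 this)
    have finish : ∀ c', 0 < c' → f (c', r) = h (c', r) → 0 ≤ f (c', r) →
        ∃ c, 0 < c ∧ ∃ r ∈ Set.Icc 0 R, h (c, r) = 0 ∧
          (f (c, r) = 0 ∨ (f (c, r) ≤ 0 ∧ r = 0)) := by
      intro c' hc' heq hpos
      have h1 : f (c', r) = 0 := by
        by_contra hne
        have : 0 < f (c', r) := lt_of_le_of_ne hpos (Ne.symm hne)
        exact not_both c' hc' ⟨this, heq ▸ this⟩
      exact ⟨c', hc', r, hr, heq ▸ h1, Or.inl h1⟩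
    have hd : ContinuousOn (fun c => f (c, r) - h (c, r)) (Set.Ioi 0) := hfr.sub hhr
    -- Move `c` to where `f = h`: rightwards `h` stays nonnegative, leftwards `f` does. The common
    -- value is then nonnegative, and by `not_both` it is zero.
    rcases le_total 0 (f (c, r) - h (c, r)) with hsgn | hsgn
    · have hcK := hcB.2
      have hKneg : f (K, r) - h (K, r) ≤ 0 := by
        have := hK K le_rfl r hr
        have := h_mono r hr c K hc hcK
        linarith
      obtain ⟨c', hc', he⟩ := intermediate_value_Icc' hcK
        (hd.mono fun x hx => lt_of_lt_of_le hc hx.1) ⟨hKneg, hsgn⟩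
      simp only [sub_eq_zero] at he
      refine finish c' (lt_of_lt_of_le hc hc'.1) he ?_
      rw [he]
      exact hhc.trans (h_mono r hr c c' hc hc'.1)
    · have hneg : 0 ≤ f (c₀, r) - h (c₀, r) := by
        have := hlow c₀ hc₀ le_rfl r hr
        have := f_anti r hr c₀ c hc₀ hcB.1
        linarith
      obtain ⟨c', hc', he⟩ := intermediate_value_Icc' hcB.1
        (hd.mono fun x hx => lt_of_lt_of_le hc₀ hx.1) ⟨hsgn, hneg⟩
      simp only [sub_eq_zero] at he
      refine finish c' (lt_of_lt_of_le hc₀ hc'.1) he ?_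
      exact hfc.trans (f_anti r hr c' c (lt_of_lt_of_le hc₀ hc'.1) hc'.2)
  -- Here the second constraint has slack already at the minimal `r = 0`: solving `h = 0` there
  -- forces `f < 0`.
  · push Not at hS
    obtain ⟨c₁, hc₁, h1⟩ := hlarge
    have hlt : c₀ ≤ c₁ := by
      by_contra! hcc
      exact absurd h1 (not_le.2 (hlow c₁ hc₁ hcc.le 0 h0R))
    obtain ⟨c, hc, he⟩ := intermediate_value_Icc hlt
      ((hslice 0 h0R h hh).mono fun x hx => lt_of_lt_of_le hc₀ hx.1)
      ⟨(hlow c₀ hc₀ le_rfl 0 h0R).le, h1⟩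
    have hc0 : 0 < c := lt_of_lt_of_le hc₀ hc.1
    refine ⟨c, hc0, 0, h0R, he, Or.inr ⟨?_, rfl⟩⟩
    by_contra! hcc
    exact absurd (hS c hc0 hcc.le) (by simp only at he; rw [he]; exact lt_irrefl _)

/-! ### Hedging positions, dual scenarios and complementary slackness -/

section Hedge

variable {Ω : Type*} {ξ U : Ω → ℝ}

/-- The position `U` where the pricing density `ξ` exceeds `c`, and `U ∧ r` elsewhere. -/
noncomputable def hedge (ξ U : Ω → ℝ) (c r : ℝ) (ω : Ω) : ℝ :=
  if c < ξ ω then U ω else min (U ω) r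

/-- The scenario `(1 ∧ ξ / c) 1_{U > r}`. -/
noncomputable def scenario (ξ U : Ω → ℝ) (c r : ℝ) (ω : Ω) : ℝ :=
  if r < U ω then min 1 (ξ ω / c) else 0

lemma hedge_nonneg {c r : ℝ} {ω : Ω} (hr : 0 ≤ r) (hU : 0 ≤ U ω) : 0 ≤ hedge ξ U c r ω := by
  unfold hedge
  split_ifs
  exacts [hU, le_min hU hr]

lemma hedge_le {c r : ℝ} {ω : Ω} : hedge ξ U c r ω ≤ U ω := by
  unfold hedge
  split_ifs
  exacts [le_rfl, min_le_left _ _]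

lemma scenario_nonneg {c r : ℝ} {ω : Ω} (hc : 0 < c) (hξ : 0 ≤ ξ ω) :
    0 ≤ scenario ξ U c r ω := by
  unfold scenario
  split_ifs
  exacts [le_min zero_le_one (by positivity), le_rfl]

lemma scenario_le_one {c r : ℝ} {ω : Ω} : scenario ξ U c r ω ≤ 1 := by
  unfold scenario
  split_ifs
  exacts [min_le_left _ _, zero_le_one]

lemma scenario_le_div {c r : ℝ} {ω : Ω} (hc : 0 < c) (hξ : 0 ≤ ξ ω) :
    scenario ξ U c r ω ≤ ξ ω / c := by
  unfold scenario
  split_ifs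
  exacts [min_le_right _ _, by positivity]

/-- The position exceeds `r` only if `ξ > c` and `U > r`, where the scenario is `1`. On the rest of
`{U > r}` the position equals `r`. -/
lemma excess_hedge {c r : ℝ} {ω : Ω} (hc : 0 < c) :
    max (hedge ξ U c r ω - r) 0 = scenario ξ U c r ω * (hedge ξ U c r ω - r) := by
  unfold hedge scenario
  split_ifs with h1 h2 h2
  · rw [min_eq_left ((one_le_div hc).2 h1.le), one_mul, max_eq_left (by linarith)]
  · rw [zero_mul, max_eq_right (by linarith)]
  · rw [min_eq_right h2.le, sub_self, mul_zero, max_self]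
  · rw [zero_mul, max_eq_right (by linarith [min_le_right (U ω) r])]

/-- The position stays below `U` only if `ξ ≤ c` and `U > r`, where the scenario equals `ξ / c`. -/
lemma slack_hedge {c r : ℝ} {ω : Ω} (hc : 0 < c) :
    (ξ ω / c - scenario ξ U c r ω) * (U ω - hedge ξ U c r ω) = 0 := by
  unfold hedge scenario
  split_ifs with h1 h2 h2
  · rw [sub_self, mul_zero]
  · rw [min_eq_right ((div_le_one hc).2 (not_lt.1 h2)), sub_self, zero_mul]
  · rw [sub_self, mul_zero]
  · rw [min_eq_left (not_lt.1 h1), sub_self, mul_zero]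

variable [MeasurableSpace Ω] {μ : Measure Ω} {p : ℝ}

lemma measurable_hedge (hξ : Measurable ξ) (hU : Measurable U) (c r : ℝ) :
    Measurable (hedge ξ U c r) :=
  Measurable.ite (measurableSet_lt measurable_const hξ) hU (hU.min measurable_const)

lemma measurable_scenario (hξ : Measurable ξ) (hU : Measurable U) (c r : ℝ) :
    Measurable (scenario ξ U c r) :=
  Measurable.ite (measurableSet_lt measurable_const hU)
    (measurable_const.min (hξ.div_const c)) measurable_const

lemma integrable_scenario [IsFiniteMeasure μ] {c r : ℝ} (hξ : Measurable ξ) (hU : Measurable U)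
    (hξ0 : ∀ᵐ ω ∂μ, 0 ≤ ξ ω) (hc : 0 < c) : Integrable (scenario ξ U c r) μ := by
  refine Integrable.of_bound (measurable_scenario hξ hU c r).aestronglyMeasurable 1 ?_
  filter_upwards [hξ0] with ω h
  rw [Real.norm_eq_abs, abs_of_nonneg (scenario_nonneg hc h)]
  exact scenario_le_one

/-- Integrability of a product whose second factor is dominated. -/
lemma integrable_mul_of_le {a Y V : Ω → ℝ} (ha : AEStronglyMeasurable a μ)
    (hY : AEStronglyMeasurable Y μ) (hV : Integrable (fun ω => a ω * V ω) μ)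
    (hY0 : ∀ᵐ ω ∂μ, 0 ≤ Y ω) (hYV : ∀ᵐ ω ∂μ, Y ω ≤ V ω) :
    Integrable (fun ω => a ω * Y ω) μ := by
  refine Integrable.mono hV (ha.mul hY) ?_
  filter_upwards [hY0, hYV] with ω h0 h1
  rw [norm_mul, norm_mul, Real.norm_eq_abs (Y ω), Real.norm_eq_abs (V ω), abs_of_nonneg h0,
    abs_of_nonneg (h0.trans h1)]
  gcongr

/-- Optimality of the hedging position under complementary slackness. -/
lemma ES_hedge_le [IsProbabilityMeasure μ] (hp : p ∈ Set.Ioo (0 : ℝ) 1)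
    (hξ : Measurable ξ) (hU : Measurable U) (hξ0 : ∀ᵐ ω ∂μ, 0 ≤ ξ ω) (hU0 : ∀ᵐ ω ∂μ, 0 ≤ U ω)
    (hUi : Integrable U μ) (hξU : Integrable (fun ω => ξ ω * U ω) μ)
    {c r : ℝ} (hc : 0 < c) (hr : 0 ≤ r)
    (hslack : ∫ ω, scenario ξ U c r ω ∂μ = 1 - p ∨
      (∫ ω, scenario ξ U c r ω ∂μ ≤ 1 - p ∧ r = 0))
    {Y : Ω → ℝ} (hY : Measurable Y) (hY0 : ∀ᵐ ω ∂μ, 0 ≤ Y ω) (hYU : ∀ᵐ ω ∂μ, Y ω ≤ U ω)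
    (hbudget : ∫ ω, ξ ω * hedge ξ U c r ω ∂μ ≤ ∫ ω, ξ ω * Y ω ∂μ) :
    ES μ p (hedge ξ U c r) ≤ ES μ p Y := by
  have hp' : 0 < 1 - p := sub_pos.2 hp.2
  set w := scenario ξ U c r
  set G := hedge ξ U c r
  have hwm : Measurable w := measurable_scenario hξ hU c r
  have hGm : Measurable G := measurable_hedge hξ hU c r
  have hw0 : ∀ᵐ ω ∂μ, 0 ≤ w ω := hξ0.mono fun ω h => scenario_nonneg hc h
  have hw1 : ∀ᵐ ω ∂μ, w ω ≤ 1 := ae_of_all _ fun ω => scenario_le_one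
  have hG0 : ∀ᵐ ω ∂μ, 0 ≤ G ω := hU0.mono fun ω h => hedge_nonneg hr h
  have hGU : ∀ᵐ ω ∂μ, G ω ≤ U ω := ae_of_all _ fun ω => hedge_le
  have hwi : Integrable w μ := integrable_scenario hξ hU hξ0 hc
  have hwU : Integrable (fun ω => w ω * U ω) μ := by
    refine Integrable.mono hUi (hwm.mul hU).aestronglyMeasurable ?_
    filter_upwards [hw0, hw1] with ω a b
    rw [norm_mul, Real.norm_eq_abs (w ω), abs_of_nonneg a]
    exact mul_le_of_le_one_left (norm_nonneg _) b
  have int1 : ∀ V : Ω → ℝ, Measurable V → (∀ᵐ ω ∂μ, 0 ≤ V ω) → (∀ᵐ ω ∂μ, V ω ≤ U ω) →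
      Integrable V μ ∧ Integrable (fun ω => w ω * V ω) μ ∧ Integrable (fun ω => ξ ω * V ω) μ := by
    intro V hV h0 h1
    refine ⟨?_, integrable_mul_of_le hwm.aestronglyMeasurable hV.aestronglyMeasurable hwU h0 h1,
      integrable_mul_of_le hξ.aestronglyMeasurable hV.aestronglyMeasurable hξU h0 h1⟩
    have := integrable_mul_of_le (a := fun _ => (1 : ℝ)) (μ := μ) aestronglyMeasurable_const
      hV.aestronglyMeasurable (by simpa using hUi) h0 h1
    simpa using this
  obtain ⟨hGi, hwG, hξG⟩ := int1 G hGm hG0 hGU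
  obtain ⟨hYi, hwY, hξY⟩ := int1 Y hY hY0 hYU
  have hmass : ∫ ω, w ω ∂μ ≤ 1 - p := hslack.elim le_of_eq And.left
  -- Take `t = r` in the Rockafellar-Uryasev objective. The remainder `r (1 - E[w] / (1 - p))`
  -- vanishes under either alternative of `hslack`.
  have upper : ES μ p G ≤ ((1 / (1 - p) * ∫ ω, w ω * G ω ∂μ : ℝ) : EReal) := by
    refine (ES_le_ruObjective hGm hGi hp r).trans (EReal.coe_le_coe_iff.2 ?_)
    have e : ∫ ω, max (G ω - r) 0 ∂μ = (∫ ω, w ω * G ω ∂μ) - r * ∫ ω, w ω ∂μ := by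
      rw [← integral_const_mul, ← integral_sub hwG (hwi.const_mul r)]
      refine integral_congr_ae (ae_of_all _ fun ω => ?_)
      have := excess_hedge (ξ := ξ) (U := U) (r := r) (ω := ω) hc
      change max (G ω - r) 0 = w ω * (G ω - r) at this
      simp only [this]
      ring
    rw [ruObjective, e]
    rcases hslack with h | ⟨-, h⟩
    · rw [h]
      field_simp
      linarith
    · rw [h]
      simp
  refine upper.trans (le_trans (EReal.coe_le_coe_iff.2 ?_)
    (le_ES_of_scenario hY hYi hp hY0 hwm hw0 hw1 hmass))
  refine mul_le_mul_of_nonneg_left ?_ (by positivity)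
  -- Split `w = ξ/c - (ξ/c - w)`. The first part compares prices; the second has nonnegative weight,
  -- so its integral is largest at `U`, and `G` attains that value by slackness.
  have expand : ∀ V : Ω → ℝ, Integrable (fun ω => w ω * V ω) μ →
      Integrable (fun ω => ξ ω * V ω) μ → ∫ ω, w ω * V ω ∂μ
        = (1 / c) * ∫ ω, ξ ω * V ω ∂μ - ∫ ω, (ξ ω / c - w ω) * V ω ∂μ := by
    intro V h1 h2
    rw [← integral_const_mul, ← integral_sub (h2.const_mul _)]
    · congr 1; ext ω; ring
    · refine ((h2.const_mul (1 / c)).sub h1).congr (ae_of_all _ fun ω => ?_)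
      simp only [Pi.sub_apply]; ring
  have hdiff : ∀ V : Ω → ℝ, Integrable (fun ω => w ω * V ω) μ →
      Integrable (fun ω => ξ ω * V ω) μ → Integrable (fun ω => (ξ ω / c - w ω) * V ω) μ := by
    intro V h1 h2
    refine ((h2.const_mul (1 / c)).sub h1).congr (ae_of_all _ fun ω => ?_)
    simp only [Pi.sub_apply]; ring
  rw [expand G hwG hξG, expand Y hwY hξY]
  have hslackG : ∫ ω, (ξ ω / c - w ω) * G ω ∂μ = ∫ ω, (ξ ω / c - w ω) * U ω ∂μ := by
    refine integral_congr_ae (ae_of_all _ fun ω => ?_)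
    have := slack_hedge (ξ := ξ) (U := U) (r := r) (ω := ω) hc
    change (ξ ω / c - w ω) * (U ω - G ω) = 0 at this
    simp only
    linarith
  have hslackY : ∫ ω, (ξ ω / c - w ω) * Y ω ∂μ ≤ ∫ ω, (ξ ω / c - w ω) * U ω ∂μ := by
    refine integral_mono_ae (hdiff Y hwY hξY) (hdiff U hwU hξU) ?_
    filter_upwards [hξ0, hYU] with ω h1 h2
    exact mul_le_mul_of_nonneg_left h2 (sub_nonneg.2 (scenario_le_div hc h1))
  have : 1 / c * ∫ ω, ξ ω * G ω ∂μ ≤ 1 / c * ∫ ω, ξ ω * Y ω ∂μ := by gcongr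
  linarith

lemma integrable_mul_hedge (hξ : Measurable ξ) (hU : Measurable U) (hU0 : ∀ᵐ ω ∂μ, 0 ≤ U ω)
    (hξU : Integrable (fun ω => ξ ω * U ω) μ) (c : ℝ) {r : ℝ} (hr : 0 ≤ r) :
    Integrable (fun ω => ξ ω * hedge ξ U c r ω) μ :=
  integrable_mul_of_le hξ.aestronglyMeasurable (measurable_hedge hξ hU c r).aestronglyMeasurable
    hξU (hU0.mono fun _ h => hedge_nonneg hr h) (ae_of_all _ fun _ => hedge_le)

lemma integral_mul_hedge_mono (hξ : Measurable ξ) (hU : Measurable U) (hξ0 : ∀ᵐ ω ∂μ, 0 ≤ ξ ω)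
    (hU0 : ∀ᵐ ω ∂μ, 0 ≤ U ω) (hξU : Integrable (fun ω => ξ ω * U ω) μ) {c c' r r' : ℝ}
    (hc : c ≤ c') (hr' : 0 ≤ r') (hr : r' ≤ r) :
    ∫ ω, ξ ω * hedge ξ U c' r' ω ∂μ ≤ ∫ ω, ξ ω * hedge ξ U c r ω ∂μ := by
  refine integral_mono_ae (integrable_mul_hedge hξ hU hU0 hξU c' hr')
    (integrable_mul_hedge hξ hU hU0 hξU c (hr'.trans hr)) ?_
  filter_upwards [hξ0] with ω h
  refine mul_le_mul_of_nonneg_left ?_ h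
  unfold hedge
  split_ifs with h1 h2 h2
  · exact le_rfl
  · exact absurd (hc.trans_lt h1) h2
  · exact min_le_left _ _
  · exact min_le_min_left _ hr

/-- The integrand can jump only when `c` crosses `ξ ω`, which is null for each fixed `c`; dominated
convergence does the rest. -/
lemma continuousOn_integral_mul_hedge (hξ : Measurable ξ) (hU : Measurable U)
    (hU0 : ∀ᵐ ω ∂μ, 0 ≤ U ω) (hξU : Integrable (fun ω => ξ ω * U ω) μ)
    (hatom : ∀ k, ∀ᵐ ω ∂μ, ξ ω ≠ k) :
    ContinuousOn (fun z : ℝ × ℝ => ∫ ω, ξ ω * hedge ξ U z.1 z.2 ω ∂μ)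
      (Set.univ ×ˢ Set.Ici 0) := by
  rintro ⟨c, r⟩ -
  refine continuousWithinAt_of_dominated (bound := fun ω => ‖ξ ω * U ω‖) ?_ ?_ hξU.norm ?_
  · exact Filter.Eventually.of_forall fun z =>
      (hξ.mul (measurable_hedge hξ hU z.1 z.2)).aestronglyMeasurable
  · filter_upwards [self_mem_nhdsWithin] with z hz
    filter_upwards [hU0] with ω h0
    rw [norm_mul, norm_mul, Real.norm_eq_abs (U ω), Real.norm_eq_abs (hedge _ _ _ _ _),
      abs_of_nonneg h0, abs_of_nonneg (hedge_nonneg hz.2 h0)]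
    exact mul_le_mul_of_nonneg_left hedge_le (norm_nonneg _)
  · filter_upwards [hatom c] with ω h
    refine ContinuousAt.continuousWithinAt (continuousAt_const.mul ?_)
    have hfst : ContinuousAt (fun z : ℝ × ℝ => z.1) (c, r) := continuousAt_fst
    rcases lt_or_gt_of_ne h with h1 | h1
    · have : (fun z : ℝ × ℝ => min (U ω) z.2) =ᶠ[𝓝 (c, r)] fun z => hedge ξ U z.1 z.2 ω := by
        filter_upwards [hfst.eventually_const_lt h1] with z hz
        rw [hedge, if_neg (not_lt.2 hz.le)]
      exact ContinuousAt.congr (by fun_prop) this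
    · have : (fun z : ℝ × ℝ => U ω) =ᶠ[𝓝 (c, r)] fun z => hedge ξ U z.1 z.2 ω := by
        filter_upwards [hfst.eventually_lt_const h1] with z hz
        rw [hedge, if_pos hz]
      exact ContinuousAt.congr (by fun_prop) this

/-- Jumps occur only when `r` crosses `U ω`; in `c` the integrand is continuous for `c > 0`. -/
lemma continuousOn_integral_scenario [IsFiniteMeasure μ] (hξ : Measurable ξ) (hU : Measurable U)
    (hξ0 : ∀ᵐ ω ∂μ, 0 ≤ ξ ω) {R : ℝ} (hatom : ∀ r ∈ Set.Icc 0 R, ∀ᵐ ω ∂μ, U ω ≠ r) :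
    ContinuousOn (fun z : ℝ × ℝ => ∫ ω, scenario ξ U z.1 z.2 ω ∂μ)
      (Set.Ioi 0 ×ˢ Set.Icc 0 R) := by
  rintro ⟨c, r⟩ ⟨hc, hr⟩
  refine continuousWithinAt_of_dominated (bound := fun _ => 1) ?_ ?_ (integrable_const 1) ?_
  · exact Filter.Eventually.of_forall fun z =>
      (measurable_scenario hξ hU z.1 z.2).aestronglyMeasurable
  · filter_upwards [self_mem_nhdsWithin] with z hz
    filter_upwards [hξ0] with ω h0
    rw [Real.norm_eq_abs, abs_of_nonneg (scenario_nonneg hz.1 h0)]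
    exact scenario_le_one
  · filter_upwards [hatom r hr] with ω h
    refine ContinuousAt.continuousWithinAt ?_
    have hsnd : ContinuousAt (fun z : ℝ × ℝ => z.2) (c, r) := continuousAt_snd
    have hc' : c ≠ 0 := ne_of_gt hc
    rcases lt_or_gt_of_ne h with h1 | h1
    · have : (fun z : ℝ × ℝ => (0 : ℝ)) =ᶠ[𝓝 (c, r)] fun z => scenario ξ U z.1 z.2 ω := by
        filter_upwards [hsnd.eventually_const_lt h1] with z hz
        rw [scenario, if_neg (not_lt.2 hz.le)]
      exact ContinuousAt.congr (by fun_prop) this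
    · have : (fun z : ℝ × ℝ => min 1 (ξ ω / z.1)) =ᶠ[𝓝 (c, r)]
          fun z => scenario ξ U z.1 z.2 ω := by
        filter_upwards [hsnd.eventually_lt_const h1] with z hz
        rw [scenario, if_pos hz]
      refine ContinuousAt.congr ?_ this
      exact continuousAt_const.min (continuousAt_const.div continuousAt_fst hc')

lemma integral_scenario_antitone [IsFiniteMeasure μ] (hξ : Measurable ξ) (hU : Measurable U)
    (hξ0 : ∀ᵐ ω ∂μ, 0 ≤ ξ ω) {c c' : ℝ} (r : ℝ) (hc : 0 < c) (hcc : c ≤ c') :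
    ∫ ω, scenario ξ U c' r ω ∂μ ≤ ∫ ω, scenario ξ U c r ω ∂μ := by
  refine integral_mono_ae (integrable_scenario hξ hU hξ0 (hc.trans_le hcc))
    (integrable_scenario hξ hU hξ0 hc) ?_
  filter_upwards [hξ0] with ω h
  unfold scenario
  split_ifs
  · gcongr
  · exact le_rfl

lemma tendsto_integral_mul_hedge_zero (hξ : Measurable ξ) (hU : Measurable U)
    (hξ0 : ∀ᵐ ω ∂μ, 0 < ξ ω) (hU0 : ∀ᵐ ω ∂μ, 0 ≤ U ω)
    (hξU : Integrable (fun ω => ξ ω * U ω) μ) :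
    Filter.Tendsto (fun c => ∫ ω, ξ ω * hedge ξ U c 0 ω ∂μ) (𝓝[>] 0)
      (𝓝 (∫ ω, ξ ω * U ω ∂μ)) := by
  refine tendsto_integral_filter_of_dominated_convergence (fun ω => ‖ξ ω * U ω‖)
    ?_ ?_ hξU.norm ?_
  · exact Filter.Eventually.of_forall fun c =>
      (hξ.mul (measurable_hedge hξ hU c 0)).aestronglyMeasurable
  · refine Filter.Eventually.of_forall fun c => ?_
    filter_upwards [hU0] with ω h0
    rw [norm_mul, norm_mul, Real.norm_eq_abs (U ω), Real.norm_eq_abs (hedge _ _ _ _ _),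
      abs_of_nonneg h0, abs_of_nonneg (hedge_nonneg le_rfl h0)]
    exact mul_le_mul_of_nonneg_left hedge_le (norm_nonneg _)
  · filter_upwards [hξ0] with ω h
    refine tendsto_const_nhds.congr' ?_
    filter_upwards [(Iio_mem_nhds h : Set.Iio (ξ ω) ∈ 𝓝 0) |> mem_nhdsWithin_of_mem_nhds] with c hc
    rw [hedge, if_pos (show c < ξ ω from hc)]

lemma tendsto_integral_mul_hedge_atTop (hξ : Measurable ξ) (hU : Measurable U)
    (hU0 : ∀ᵐ ω ∂μ, 0 ≤ U ω) (hξU : Integrable (fun ω => ξ ω * U ω) μ) :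
    Filter.Tendsto (fun c => ∫ ω, ξ ω * hedge ξ U c 0 ω ∂μ) Filter.atTop (𝓝 0) := by
  have e : 𝓝 (0 : ℝ) = 𝓝 (∫ _, (0 : ℝ) ∂μ) := by rw [integral_zero]
  rw [e]
  refine tendsto_integral_filter_of_dominated_convergence (fun ω => ‖ξ ω * U ω‖)
    ?_ ?_ hξU.norm ?_
  · exact Filter.Eventually.of_forall fun c =>
      (hξ.mul (measurable_hedge hξ hU c 0)).aestronglyMeasurable
  · refine Filter.Eventually.of_forall fun c => ?_
    filter_upwards [hU0] with ω h0
    rw [norm_mul, norm_mul, Real.norm_eq_abs (U ω), Real.norm_eq_abs (hedge _ _ _ _ _),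
      abs_of_nonneg h0, abs_of_nonneg (hedge_nonneg le_rfl h0)]
    exact mul_le_mul_of_nonneg_left hedge_le (norm_nonneg _)
  · filter_upwards [hU0] with ω h
    refine tendsto_const_nhds.congr' ?_
    filter_upwards [Filter.eventually_ge_atTop (ξ ω)] with c hc
    rw [hedge, if_neg (not_lt.2 hc), min_eq_right h, mul_zero]

/-- Existence of a hedging position with budget `x₀` that satisfies complementary slackness. -/
lemma exists_optimal_hedge [IsProbabilityMeasure μ] (hp : p ∈ Set.Ioo (0 : ℝ) 1)
    (hξ : Measurable ξ) (hU : Measurable U) (hξ0 : ∀ᵐ ω ∂μ, 0 < ξ ω) (hU0 : ∀ᵐ ω ∂μ, 0 ≤ U ω)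
    (hξi : Integrable ξ μ) (hξ1 : ∫ ω, ξ ω ∂μ = 1)
    (hξU : Integrable (fun ω => ξ ω * U ω) μ) (hatom : ∀ k, ∀ᵐ ω ∂μ, ξ ω ≠ k)
    {x₀ R : ℝ} (hx0 : 0 < x₀) (hx1 : x₀ < ∫ ω, ξ ω * U ω ∂μ) (hR : 0 ≤ R)
    (hUatom : ∀ r ∈ Set.Icc 0 R, ∀ᵐ ω ∂μ, U ω ≠ r)
    (hend : ∀ c, 0 < c → ¬ (1 - p ≤ ∫ ω, scenario ξ U c R ω ∂μ ∧
      ∫ ω, ξ ω * hedge ξ U c R ω ∂μ ≤ x₀)) :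
    ∃ c, 0 < c ∧ ∃ r ∈ Set.Icc 0 R, ∫ ω, ξ ω * hedge ξ U c r ω ∂μ = x₀ ∧
      (∫ ω, scenario ξ U c r ω ∂μ = 1 - p ∨
        (∫ ω, scenario ξ U c r ω ∂μ ≤ 1 - p ∧ r = 0)) := by
  have hp' : 0 < 1 - p := sub_pos.2 hp.2
  have hξ0' : ∀ᵐ ω ∂μ, 0 ≤ ξ ω := hξ0.mono fun _ h => h.le
  obtain ⟨c₀, hc₀, hc₀pos⟩ := (((tendsto_integral_mul_hedge_zero hξ hU hξ0 hU0
    hξU).eventually_const_lt hx1).and self_mem_nhdsWithin).exists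
  obtain ⟨c₁, hc₁, hc₁pos⟩ := (((tendsto_integral_mul_hedge_atTop hξ hU hU0
    hξU).eventually_lt_const hx0).and (Filter.eventually_gt_atTop 0)).exists
  -- `f` is the excess of the scenario mass over `1 - p`, and `h` the shortfall of the price below
  -- `x₀`. The mass is at most `1 / c`, hence the choice of `K`; for `c ≤ c₀` even `r = 0` costs
  -- more than `x₀`, and at `c₁` it costs less.
  obtain ⟨c, hc, r, hr, h1, h2⟩ := exists_complementary_pair (R := R) (K := 1 / (1 - p) + 1)
    (c₀ := c₀) (f := fun z => (∫ ω, scenario ξ U z.1 z.2 ω ∂μ) - (1 - p))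
    (h := fun z => x₀ - ∫ ω, ξ ω * hedge ξ U z.1 z.2 ω ∂μ) hR
    ((continuousOn_integral_scenario hξ hU hξ0' hUatom).sub continuousOn_const)
    (continuousOn_const.sub ((continuousOn_integral_mul_hedge hξ hU hU0 hξU hatom).mono
      (Set.prod_mono (Set.subset_univ _) fun x hx => hx.1)))
    (fun r _ c c' hc hcc => sub_le_sub_right (integral_scenario_antitone hξ hU hξ0' r hc hcc) _)
    (fun r hr c c' hc hcc => sub_le_sub_left
      (integral_mul_hedge_mono hξ hU hξ0' hU0 hξU hcc hr.1 le_rfl) _)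
    hc₀pos
    (fun c hc hcc r hr => sub_neg.2 (hc₀.trans_le
      (integral_mul_hedge_mono hξ hU hξ0' hU0 hξU hcc le_rfl hr.1)))
    (fun c hc r hr => by
      have hκ : 0 < 1 / (1 - p) := by positivity
      have hcpos : 0 < c := by linarith
      have hle : ∫ ω, scenario ξ U c r ω ∂μ ≤ ∫ ω, ξ ω / c ∂μ :=
        integral_mono_ae (integrable_scenario hξ hU hξ0' hcpos) (hξi.div_const c)
          (hξ0'.mono fun ω h => scenario_le_div hcpos h)
      rw [integral_div, hξ1] at hle
      have : 1 / c < 1 - p := by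
        rw [div_lt_comm₀ hcpos hp']
        linarith
      simp only
      linarith)
    ⟨c₁, hc₁pos, sub_nonneg.2 hc₁.le⟩
    (fun c hc h => hend c hc ⟨sub_nonneg.1 h.1, sub_nonneg.1 h.2⟩)
  refine ⟨c, hc, r, hr, (sub_eq_zero.1 h1).symm, h2.imp sub_eq_zero.1 fun h => ⟨?_, h.2⟩⟩
  exact sub_nonpos.1 h.1

end Hedge

/-! ### Robustness through neighborhood filters -/

section Neighborhoods

variable {Ω E : Type*} [MeasurableSpace Ω] [MeasurableSpace E]

/-- The neighborhood filter of a random element for the pseudo-metric of the model space. -/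
def ModelSpace.neighborhoods (M : ModelSpace Ω E) (X : M.carrier) : Filter M.carrier :=
  Filter.comap (fun Z => M.pseudoMetric.dist Z X) (𝓝 0)

/-- Countable generation lets convergence be tested along subsequences, where almost sure limits are
available. -/
instance (M : ModelSpace Ω E) (X : M.carrier) : (M.neighborhoods X).IsCountablyGenerated :=
  inferInstanceAs (Filter.comap _ _).IsCountablyGenerated

instance (M : ModelSpace Ω E) (X : M.carrier) : (M.neighborhoods X).NeBot := by
  let _ := M.pseudoMetric
  have h : M.neighborhoods X = 𝓝 X := nhds_comap_dist X
  rw [h]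
  infer_instance

lemma isRobustOptimizer_of_le {ρ : (Ω → ℝ) → EReal} {T : UncertaintyTriplet Ω E}
    {X : T.models.carrier} {g : E → ℝ} (hg : g ∈ T.admissible)
    (hopt : ∀ h ∈ T.admissible, ρ (fun ω => g (X.1 ω)) ≤ ρ (fun ω => h (X.1 ω)))
    (hcont : Filter.Tendsto (fun Z : T.models.carrier => ρ (fun ω => g (Z.1 ω)))
      (T.models.neighborhoods X) (𝓝 (ρ (fun ω => g (X.1 ω))))) :
    IsRobustOptimizer ρ T X g := by
  let _ := T.models.pseudoMetric
  have h : T.models.neighborhoods X = 𝓝 X := nhds_comap_dist X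
  rw [h] at hcont
  exact ⟨⟨hg, le_antisymm (le_iInf₂ hopt) (iInf₂_le g hg)⟩, hcont⟩

end Neighborhoods

/-! ### Continuity of Expected Shortfall and convergence of laws -/

section Continuity

variable {Ω : Type*} [MeasurableSpace Ω] {μ : Measure Ω} [IsProbabilityMeasure μ] {p : ℝ}

/-- Each `VaR` minimizes its own objective, so inserting the other's minimizer bounds the difference
both ways. -/
lemma abs_ruObjective_VaR_sub_le (hp : p ∈ Set.Ioo (0 : ℝ) 1) {Y Z : Ω → ℝ} (hY : Measurable Y)
    (hZ : Measurable Z) (hYi : Integrable Y μ) (hZi : Integrable Z μ) {D : ℝ}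
    (hDY : |(∫ ω, max (Y ω - VaR μ p Y) 0 ∂μ) - ∫ ω, max (Z ω - VaR μ p Y) 0 ∂μ| ≤ D)
    (hDZ : |(∫ ω, max (Y ω - VaR μ p Z) 0 ∂μ) - ∫ ω, max (Z ω - VaR μ p Z) 0 ∂μ| ≤ D) :
    |ruObjective μ p Y (VaR μ p Y) - ruObjective μ p Z (VaR μ p Z)| ≤ 1 / (1 - p) * D := by
  have hp' : 0 < 1 - p := sub_pos.2 hp.2
  have h1 := ruObjective_VaR_le hY hYi hp (VaR μ p Z)
  have h2 := ruObjective_VaR_le hZ hZi hp (VaR μ p Y)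
  have hκ : 0 ≤ 1 / (1 - p) := by positivity
  have h3 := mul_le_mul_of_nonneg_left (abs_le.1 hDY).1 hκ
  have h4 := mul_le_mul_of_nonneg_left (abs_le.1 hDZ).2 hκ
  unfold ruObjective at *
  rw [abs_le]
  constructor <;> linarith

/-- Excess expectations that converge uniformly over thresholds in `S` suffice; the quantiles
themselves need not converge. -/
lemma tendsto_ES {ι : Type*} {l : Filter ι} (hp : p ∈ Set.Ioo (0 : ℝ) 1) {Z : ι → Ω → ℝ}
    {Y : Ω → ℝ} (hZ : ∀ i, Measurable (Z i)) (hZi : ∀ i, Integrable (Z i) μ) (hY : Measurable Y)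
    (hYi : Integrable Y μ) {S : Set ℝ} (hZS : ∀ i, VaR μ p (Z i) ∈ S) (hYS : VaR μ p Y ∈ S)
    {D : ι → ℝ} (hD : Filter.Tendsto D l (𝓝 0))
    (hle : ∀ i, ∀ t ∈ S, |(∫ ω, max (Z i ω - t) 0 ∂μ) - ∫ ω, max (Y ω - t) 0 ∂μ| ≤ D i) :
    Filter.Tendsto (fun i => ES μ p (Z i)) l (𝓝 (ES μ p Y)) := by
  simp only [fun i => ES_eq_ruObjective (hZ i) (hZi i) hp, ES_eq_ruObjective hY hYi hp]
  refine (continuous_coe_real_ereal.tendsto _).comp ?_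
  rw [tendsto_iff_norm_sub_tendsto_zero]
  have hD' : Filter.Tendsto (fun i => 1 / (1 - p) * D i) l (𝓝 0) := by
    simpa only [mul_zero] using hD.const_mul (1 / (1 - p))
  refine squeeze_zero (fun _ => norm_nonneg _) (fun i => ?_) hD'
  exact abs_ruObjective_VaR_sub_le hp (hZ i) hY (hZi i) hYi (hle i _ (hZS i)) (hle i _ hYS)

lemma tendsto_ES_of_tendsto_integral_abs_sub {ι : Type*} {l : Filter ι}
    (hp : p ∈ Set.Ioo (0 : ℝ) 1) {Z : ι → Ω → ℝ}
    {Y : Ω → ℝ} (hZ : ∀ i, Measurable (Z i)) (hZi : ∀ i, Integrable (Z i) μ) (hY : Measurable Y)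
    (hYi : Integrable Y μ)
    (hD : Filter.Tendsto (fun i => ∫ ω, |Z i ω - Y ω| ∂μ) l (𝓝 0)) :
    Filter.Tendsto (fun i => ES μ p (Z i)) l (𝓝 (ES μ p Y)) := by
  refine tendsto_ES hp hZ hZi hY hYi (S := Set.univ) (fun _ => trivial) trivial hD fun i t _ => ?_
  rw [← integral_sub (Integrable.excess (hZi i) t) (Integrable.excess hYi t)]
  refine abs_integral_le_integral_abs.trans (integral_mono
    ((Integrable.excess (hZi i) t).sub (Integrable.excess hYi t)).abs
    ((hZi i).sub hYi).abs fun ω => ?_)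
  have := abs_max_sub_max_le_abs (Z i ω - t) (Y ω - t) 0
  simpa using this

/-- Along a subsequence, Expected Shortfall of a transform of linear growth is continuous in `L¹`
at a point where the transform is almost surely continuous. -/
lemma exists_subseq_tendsto_ES (hp : p ∈ Set.Ioo (0 : ℝ) 1) {g : ℝ → ℝ} (hg : Measurable g)
    (hgrow : ∀ x, |g x| ≤ |x|) {X : Ω → ℝ} (hX : Measurable X) (hXi : Integrable X μ)
    (hcont : ∀ᵐ ω ∂μ, ContinuousAt g (X ω)) {Z : ℕ → Ω → ℝ} (hZ : ∀ n, Measurable (Z n))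
    (hZi : ∀ n, Integrable (Z n) μ)
    (hlim : Filter.Tendsto (fun n => eLpNorm (Z n - X) 1 μ) Filter.atTop (𝓝 0)) :
    ∃ ms : ℕ → ℕ, Filter.Tendsto (fun n => ES μ p (fun ω => g (Z (ms n) ω))) Filter.atTop
      (𝓝 (ES μ p (fun ω => g (X ω)))) := by
  obtain ⟨ms, hms, hae⟩ := (tendstoInMeasure_of_tendsto_eLpNorm one_ne_zero
    (fun n => (hZ n).aestronglyMeasurable) hX.aestronglyMeasurable hlim).exists_seq_tendsto_ae
  refine ⟨ms, ?_⟩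
  have hint : ∀ V : Ω → ℝ, Measurable V → Integrable V μ → Integrable (fun ω => g (V ω)) μ :=
    fun V hV hi => Integrable.mono hi (hg.comp hV).aestronglyMeasurable
      (ae_of_all _ fun ω => hgrow (V ω))
  refine tendsto_ES_of_tendsto_integral_abs_sub hp (fun n => hg.comp (hZ (ms n)))
    (fun n => hint _ (hZ (ms n)) (hZi (ms n))) (hg.comp hX) (hint _ hX hXi) ?_
  set a : ℕ → Ω → ℝ := fun n ω => |g (Z (ms n) ω) - g (X ω)|
  set b : ℕ → Ω → ℝ := fun n ω => |Z (ms n) ω - X ω|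
  have hai : ∀ n, Integrable (a n) μ := fun n =>
    ((hint _ (hZ (ms n)) (hZi (ms n))).sub (hint _ hX hXi)).abs
  have hbi : ∀ n, Integrable (b n) μ := fun n => ((hZi (ms n)).sub hXi).abs
  have hb : Filter.Tendsto (fun n => ∫ ω, b n ω ∂μ) Filter.atTop (𝓝 0) := by
    have h1 : ∀ n, ∫ ω, b n ω ∂μ = (eLpNorm (Z (ms n) - X) 1 μ).toReal := by
      intro n
      rw [eLpNorm_one_eq_lintegral_enorm, ← integral_norm_eq_lintegral_enorm
        ((hZ (ms n)).sub hX).aestronglyMeasurable]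
      rfl
    simp only [h1]
    exact (ENNReal.tendsto_toReal ENNReal.zero_ne_top).comp (hlim.comp hms.tendsto_atTop)
  -- No fixed integrable function need dominate `a n`, but linear growth gives `(a n - b n)⁺ ≤
  -- 2|X|`, while `b n` tends to zero in `L¹`.
  have hab : Filter.Tendsto (fun n => ∫ ω, max (a n ω - b n ω) 0 ∂μ) Filter.atTop (𝓝 0) := by
    have e : 𝓝 (0 : ℝ) = 𝓝 (∫ _, (0 : ℝ) ∂μ) := by rw [integral_zero]
    rw [e]
    refine tendsto_integral_of_dominated_convergence (fun ω => 2 * |X ω|)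
      (fun n => ((hai n).sub (hbi n)).pos_part.aestronglyMeasurable) (hXi.abs.const_mul 2)
      (fun n => ae_of_all _ fun ω => ?_) ?_
    · rw [Real.norm_eq_abs, abs_of_nonneg (le_max_right _ _)]
      refine max_le ?_ (by positivity)
      have h1 := hgrow (Z (ms n) ω)
      have h2 := hgrow (X ω)
      have h3 := abs_sub (g (Z (ms n) ω)) (g (X ω))
      have h4 : |Z (ms n) ω| ≤ |Z (ms n) ω - X ω| + |X ω| := by
        simpa using abs_add_le (Z (ms n) ω - X ω) (X ω)
      simp only [a, b]
      linarith
    · filter_upwards [hae, hcont] with ω h1 h2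
      have h3 : Filter.Tendsto (fun n => a n ω) Filter.atTop (𝓝 0) := by
        have := ((h2.tendsto.comp h1).sub_const (g (X ω))).abs
        simpa using this
      have h4 : Filter.Tendsto (fun n => b n ω) Filter.atTop (𝓝 0) := by
        simpa using (h1.sub_const (X ω)).abs
      simpa using (h3.sub h4).max (tendsto_const_nhds (x := (0 : ℝ)))
  refine squeeze_zero (fun n => integral_nonneg fun ω => abs_nonneg _) (fun n => ?_)
    (by simpa using hb.add hab)
  have hpi : Integrable (fun ω => max (a n ω - b n ω) 0) μ := ((hai n).sub (hbi n)).pos_part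
  rw [← integral_add (hbi n) hpi]
  refine integral_mono (hai n) ((hbi n).add hpi) fun ω => ?_
  have := le_max_left (a n ω - b n ω) 0
  simp only
  linarith

lemma tendsto_eLpNorm_lpModels {ν : Measure Ω} {q : ℝ≥0∞} (hq : 1 ≤ q) (X : (lpModels ν q hq).carrier) :
    Filter.Tendsto (fun Z : (lpModels ν q hq).carrier => eLpNorm (Z.1 - X.1) q ν)
      ((lpModels ν q hq).neighborhoods X) (𝓝 0) := by
  rw [← ENNReal.ofReal_zero]
  refine ((ENNReal.continuous_ofReal.tendsto _).comp Filter.tendsto_comap).congr fun Z => ?_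
  exact ENNReal.ofReal_toReal (Z.2.2.sub X.2.2).2.ne

/-- The law of a random element of a model space. -/
noncomputable def ModelSpace.law (μ : Measure Ω) [IsProbabilityMeasure μ] (M : ModelSpace Ω ℝ)
    (Z : M.carrier) : ProbabilityMeasure ℝ :=
  ⟨μ.map Z.1, Measure.isProbabilityMeasure_map (M.measurable_of_mem _ Z.2).aemeasurable⟩

/-- `L^q` convergence passes through convergence in measure; the Prokhorov distance induces the weak
topology. -/
lemma IsClassicModels.tendsto_law {M : ModelSpace Ω ℝ} (hM : IsClassicModels μ M)
    (X : M.carrier) : Filter.Tendsto (M.law μ) (M.neighborhoods X) (𝓝 (M.law μ X)) := by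
  rcases hM with ⟨q, hq, rfl⟩ | rfl
  · have h := tendstoInMeasure_of_tendsto_eLpNorm (p := q) (by positivity)
      (fun Z : (lpModels μ q hq).carrier => Z.2.1.aestronglyMeasurable) X.2.1.aestronglyMeasurable
      (tendsto_eLpNorm_lpModels hq X)
    exact (h.tendstoInDistribution fun Z => Z.2.1.aemeasurable).tendsto
  · have h : Filter.Tendsto (fun Z => LevyProkhorov.ofMeasure ((weakModels μ).law μ Z))
        ((weakModels μ).neighborhoods X)
        (𝓝 (LevyProkhorov.ofMeasure ((weakModels μ).law μ X))) :=
      tendsto_iff_dist_tendsto_zero.2 Filter.tendsto_comap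
    exact ((LevyProkhorov.continuous_toMeasure_probabilityMeasure (Ω := ℝ)).tendsto _).comp h

/-- The constant sequence `Y` converges to `Z`, and weak limits of laws are unique. -/
lemma IsClassicModels.map_eq_of_dist_eq_zero {M : ModelSpace Ω ℝ} (hM : IsClassicModels μ M)
    {Y Z : M.carrier} (h : M.pseudoMetric.dist Y Z = 0) : μ.map Y.1 = μ.map Z.1 := by
  have h1 : Filter.Tendsto (fun _ : ℕ => Y) Filter.atTop (M.neighborhoods Z) := by
    refine Filter.tendsto_comap_iff.2 (tendsto_const_nhds.congr fun _ => ?_)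
    exact h.symm
  have h2 := tendsto_nhds_unique tendsto_const_nhds ((hM.tendsto_law Z).comp h1)
  exact congrArg (fun P : ProbabilityMeasure ℝ => (P : Measure ℝ)) h2

lemma isCompatible_ES (hp : p ∈ Set.Ioo (0 : ℝ) 1) {T : UncertaintyTriplet Ω ℝ}
    (hT : IsClassicModels μ T.models) : IsCompatible (ES μ p) T := by
  refine ⟨fun g hg Z hZ => ES_ne_bot ((T.measurable_of_mem g hg).comp
    (T.models.measurable_of_mem Z hZ)) hp, fun g hg Y Z h => ?_⟩
  have hgm := T.measurable_of_mem g hg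
  have hYm := T.models.measurable_of_mem _ Y.2
  have hZm := T.models.measurable_of_mem _ Z.2
  refine ES_congr_map (hgm.comp hYm) (hgm.comp hZm) ?_
  change μ.map (g ∘ Y.1) = μ.map (g ∘ Z.1)
  rw [← Measure.map_map hgm hYm, ← Measure.map_map hgm hZm, hT.map_eq_of_dist_eq_zero h]

lemma ES_congr_ae {Y Z : Ω → ℝ} (hY : Measurable Y) (hZ : Measurable Z) (h : Y =ᵐ[μ] Z) :
    ES μ p Y = ES μ p Z :=
  ES_congr_map hY hZ (Measure.map_congr h)

end Continuity

/-! ### Regularity of the candidate positions -/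

section Positions

variable {Ω : Type*} [MeasurableSpace Ω] {μ : Measure Ω} {p : ℝ}
  {X : Ω → ℝ} {γ : ℝ → ℝ}

lemma GlobalAssumptions.ae_ne (hA : GlobalAssumptions μ X γ) (a : ℝ) : ∀ᵐ ω ∂μ, X ω ≠ a := by
  obtain ⟨f, -, hlaw, -⟩ := hA.density_X
  have h : μ.map X {a} = 0 := by
    rw [hlaw]
    exact withDensity_absolutelyContinuous _ _ (measure_singleton a)
  rw [Measure.map_apply hA.measurable_X (measurableSet_singleton a)] at h
  exact measure_eq_zero_iff_ae_notMem.1 h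

lemma GlobalAssumptions.ae_pos (hA : GlobalAssumptions μ X γ) : ∀ᵐ ω ∂μ, 0 < X ω := by
  filter_upwards [hA.nonneg_X, hA.ae_ne 0] with ω h1 h2
  exact lt_of_le_of_ne h1 (Ne.symm h2)

lemma GlobalAssumptions.ae_pos_density (hA : GlobalAssumptions μ X γ) :
    ∀ᵐ ω ∂μ, 0 < γ (X ω) :=
  hA.ae_pos.mono fun _ h => hA.pos_γ _ h

lemma GlobalAssumptions.integrable_density (hA : GlobalAssumptions μ X γ) :
    Integrable (fun ω => γ (X ω)) μ := by
  by_contra h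
  have := hA.integral_γ
  rw [integral_undef h] at this
  exact zero_ne_one this

lemma GlobalAssumptions.continuousAt_density (hA : GlobalAssumptions μ X γ) {x : ℝ} (hx : 0 < x) :
    ContinuousAt γ x :=
  hA.continuousOn_γ.continuousAt (Ioi_mem_nhds hx)

lemma measurable_nsPosition (hγ : Measurable γ) (c r lam : ℝ) :
    Measurable (nsPosition γ c r lam) :=
  Measurable.ite (measurableSet_lt measurable_const hγ) measurable_id
    (Measurable.ite (measurableSet_lt hγ measurable_const) (by fun_prop) (by fun_prop))

lemma measurable_bdPosition (hγ : Measurable γ) (m c r lam : ℝ) :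
    Measurable (bdPosition γ m c r lam) :=
  Measurable.ite (measurableSet_lt measurable_const hγ) measurable_const
    (Measurable.ite (measurableSet_lt hγ measurable_const) measurable_const measurable_const)

/-- Alternative models may be negative; for `x ≤ r` every branch returns `x`, so the bound holds on
all of `ℝ`. -/
lemma abs_nsPosition_le {c r lam : ℝ} (hr : 0 ≤ r) (hlam : lam ∈ Set.Icc (0 : ℝ) 1) (x : ℝ) :
    |nsPosition γ c r lam x| ≤ |x| := by
  rcases le_total x r with h | h
  · have : nsPosition γ c r lam x = x := by
      unfold nsPosition
      rw [min_eq_left h]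
      split_ifs <;> ring
    rw [this]
  · have hx : 0 ≤ x := hr.trans h
    unfold nsPosition
    rw [min_eq_right h]
    split_ifs
    · exact le_rfl
    · rwa [abs_of_nonneg hr, abs_of_nonneg hx]
    · have h0 : 0 ≤ (1 - lam) * x := mul_nonneg (sub_nonneg.2 hlam.2) hx
      have h1 : 0 ≤ lam * r := mul_nonneg hlam.1 hr
      have h2 : lam * r ≤ lam * x := mul_le_mul_of_nonneg_left h hlam.1
      rw [abs_of_nonneg (add_nonneg h0 h1), abs_of_nonneg hx]
      linarith

lemma nsPosition_mem_Icc {c r lam x : ℝ} (hr : 0 ≤ r) (hlam : lam ∈ Set.Icc (0 : ℝ) 1)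
    (hx : 0 ≤ x) : nsPosition γ c r lam x ∈ Set.Icc 0 x := by
  refine ⟨?_, (le_abs_self _).trans ((abs_nsPosition_le hr hlam x).trans_eq (abs_of_nonneg hx))⟩
  have h0 : 0 ≤ min x r := le_min hx hr
  have h1 : 0 ≤ 1 - lam := sub_nonneg.2 hlam.2
  have h2 := hlam.1
  unfold nsPosition
  split_ifs <;> positivity

lemma GlobalAssumptions.continuousAt_nsPosition (hA : GlobalAssumptions μ X γ) {c r lam x : ℝ}
    (hx : 0 < x) (hc : γ x ≠ c) : ContinuousAt (nsPosition γ c r lam) x := by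
  have hγ := hA.continuousAt_density hx
  rcases lt_or_gt_of_ne hc with h | h
  · refine ContinuousAt.congr (f := fun y => min y r) (by fun_prop) ?_
    filter_upwards [hγ.eventually_lt_const h] with y hy
    rw [nsPosition, if_neg (not_lt.2 hy.le), if_pos hy]
  · refine ContinuousAt.congr (f := fun y => y) (by fun_prop) ?_
    filter_upwards [hγ.eventually_const_lt h] with y hy
    rw [nsPosition, if_pos hy]

lemma bdPosition_mem_Icc {m c r lam x : ℝ} (hr : r ∈ Set.Icc 0 m) (hlam : lam ∈ Set.Icc r m) :
    bdPosition γ m c r lam x ∈ Set.Icc 0 m := by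
  unfold bdPosition
  split_ifs
  exacts [⟨hr.1.trans hr.2, le_rfl⟩, hr, ⟨hr.1.trans hlam.1, hlam.2⟩]

/-- Where `x > 0` and `γ x ≠ c`, continuity of `γ` puts a whole neighborhood on one side of `c`,
hence inside `A` or inside its complement. -/
lemma GlobalAssumptions.measure_frontier_eq_zero (hA : GlobalAssumptions μ X γ) {c : ℝ}
    (hc : ∀ᵐ ω ∂μ, γ (X ω) ≠ c) {A : Set ℝ}
    (h1 : {x | c < γ x} ⊆ A ∨ {x | c < γ x} ⊆ Aᶜ) (h2 : {x | γ x < c} ⊆ A ∨ {x | γ x < c} ⊆ Aᶜ) :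
    μ.map X (frontier A) = 0 := by
  rw [Measure.map_apply hA.measurable_X isClosed_frontier.measurableSet,
    measure_eq_zero_iff_ae_notMem]
  filter_upwards [hA.ae_pos, hc] with ω hpos hne hmem
  have hγ := hA.continuousAt_density hpos
  have key : ∀ B : Set ℝ, B ∈ 𝓝 (X ω) → (B ⊆ A ∨ B ⊆ Aᶜ) → False := by
    rintro B hB (h | h)
    · exact hmem.2 (mem_interior_iff_mem_nhds.2 (Filter.mem_of_superset hB h))
    · have h3 : X ω ∈ frontier Aᶜ := by rwa [frontier_compl]
      exact h3.2 (mem_interior_iff_mem_nhds.2 (Filter.mem_of_superset hB h))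
  rcases lt_or_gt_of_ne hne with h | h
  · exact key _ (hγ.eventually_lt_const h) h2
  · exact key _ (hγ.eventually_const_lt h) h1

variable [IsProbabilityMeasure μ]

lemma GlobalAssumptions.density_eq_one (hA : GlobalAssumptions μ X γ) {k : ℝ}
    (hk : ∀ᵐ ω ∂μ, γ (X ω) = k) : ∀ᵐ ω ∂μ, γ (X ω) = 1 := by
  have h := hA.integral_γ
  rw [integral_congr_ae hk] at h
  simp only [integral_const, probReal_univ, smul_eq_mul, one_mul] at h
  rwa [h] at hk

lemma GlobalAssumptions.tendsto_ES_nsPosition (hA : GlobalAssumptions μ X γ)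
    (hp : p ∈ Set.Ioo (0 : ℝ) 1) {q : ℝ≥0∞} (hq : 1 ≤ q) (hX : X ∈ (lpModels μ q hq).carrier)
    {c r lam : ℝ} (hr : 0 ≤ r) (hlam : lam ∈ Set.Icc (0 : ℝ) 1) (hc : ∀ᵐ ω ∂μ, γ (X ω) ≠ c) :
    Filter.Tendsto (fun Z : (lpModels μ q hq).carrier =>
        ES μ p (fun ω => nsPosition γ c r lam (Z.1 ω)))
      ((lpModels μ q hq).neighborhoods ⟨X, hX⟩)
      (𝓝 (ES μ p (fun ω => nsPosition γ c r lam (X ω)))) := by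
  refine Filter.tendsto_of_subseq_tendsto fun ns hns => ?_
  refine exists_subseq_tendsto_ES (Z := fun n => (ns n).1) hp
    (measurable_nsPosition hA.measurable_γ c r lam) (abs_nsPosition_le hr hlam) hA.measurable_X
    (memLp_one_iff_integrable.1 (hX.2.mono_exponent hq)) ?_ (fun n => (ns n).2.1)
    (fun n => memLp_one_iff_integrable.1 ((ns n).2.2.mono_exponent hq)) ?_
  · filter_upwards [hA.ae_pos, hc] with ω h1 h2
    exact hA.continuousAt_nsPosition h1 h2
  · refine tendsto_of_tendsto_of_tendsto_of_le_of_le tendsto_const_nhds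
      ((tendsto_eLpNorm_lpModels hq ⟨X, hX⟩).comp hns) (fun n => bot_le) fun n => ?_
    exact eLpNorm_le_eLpNorm_of_exponent_le hq
      ((ns n).2.1.sub hA.measurable_X).aestronglyMeasurable

lemma integral_excess_bdPosition (hγ : Measurable γ) {Z : Ω → ℝ} (hZ : Measurable Z)
    (m c r lam t : ℝ) :
    ∫ ω, max (bdPosition γ m c r lam (Z ω) - t) 0 ∂μ
      = (μ.map Z).real {x | c < γ x} * max (m - t) 0 + (μ.map Z).real {x | γ x < c} * max (r - t) 0
        + (μ.map Z).real {x | γ x = c} * max (lam - t) 0 := by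
  have m1 : MeasurableSet {x | c < γ x} := measurableSet_lt measurable_const hγ
  have m2 : MeasurableSet {x | γ x < c} := measurableSet_lt hγ measurable_const
  have m3 : MeasurableSet {x | γ x = c} := measurableSet_eq_fun hγ measurable_const
  have hP := Measure.isProbabilityMeasure_map (μ := μ) hZ.aemeasurable
  rw [← integral_map (f := fun x => max (bdPosition γ m c r lam x - t) 0) hZ.aemeasurable
    (((measurable_bdPosition hγ m c r lam).sub_const t).max measurable_const).aestronglyMeasurable]
  have e : (fun x => max (bdPosition γ m c r lam x - t) 0)
      = fun x => ({x | c < γ x}.indicator (fun _ => max (m - t) 0) x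
        + {x | γ x < c}.indicator (fun _ => max (r - t) 0) x)
        + {x | γ x = c}.indicator (fun _ => max (lam - t) 0) x := by
    ext x
    simp only [bdPosition, Set.indicator, Set.mem_ofPred_eq]
    rcases lt_trichotomy (γ x) c with h | h | h
    · simp [h, h.not_gt, h.ne]
    · simp [h]
    · simp [h, h.not_gt, h.ne']
  have i1 : ∀ (A : Set ℝ) (v : ℝ), MeasurableSet A →
      Integrable (A.indicator fun _ => v) (μ.map Z) := fun A v hA =>
    (integrable_const v).indicator hA
  have i2 : Integrable (fun x => {x | c < γ x}.indicator (fun _ => max (m - t) 0) x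
      + {x | γ x < c}.indicator (fun _ => max (r - t) 0) x) (μ.map Z) :=
    (i1 _ _ m1).add (i1 _ _ m2)
  rw [e, integral_add i2 (i1 _ _ m3), integral_add (i1 _ _ m1) (i1 _ _ m2), integral_indicator_const _ m1,
    integral_indicator_const _ m2, integral_indicator_const _ m3]
  simp only [smul_eq_mul]

/-- The excess is a combination of three probabilities with coefficients at most `m` for thresholds
in `[0, m]`, so the portmanteau theorem gives uniformity in the threshold. -/
lemma GlobalAssumptions.tendsto_ES_bdPosition (hA : GlobalAssumptions μ X γ)
    (hp : p ∈ Set.Ioo (0 : ℝ) 1) {M : ModelSpace Ω ℝ} (hM : IsClassicModels μ M)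
    (hX : X ∈ M.carrier) {m c r lam : ℝ} (hr : r ∈ Set.Icc 0 m) (hlam : lam ∈ Set.Icc r m)
    (hc : ∀ᵐ ω ∂μ, γ (X ω) ≠ c) :
    Filter.Tendsto (fun Z : M.carrier => ES μ p (fun ω => bdPosition γ m c r lam (Z.1 ω)))
      (M.neighborhoods ⟨X, hX⟩) (𝓝 (ES μ p (fun ω => bdPosition γ m c r lam (X ω)))) := by
  have hγ := hA.measurable_γ
  have hgm := measurable_bdPosition hγ m c r lam
  have hmeas : ∀ Z : M.carrier, Measurable Z.1 := fun Z => M.measurable_of_mem _ Z.2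
  have hint : ∀ Z : Ω → ℝ, Measurable Z → Integrable (fun ω => bdPosition γ m c r lam (Z ω)) μ :=
    fun Z hZ => Integrable.of_bound (hgm.comp hZ).aestronglyMeasurable m (ae_of_all _ fun ω => by
      have := bdPosition_mem_Icc (γ := γ) (c := c) (x := Z ω) hr hlam
      rw [Real.norm_eq_abs, abs_of_nonneg this.1]
      exact this.2)
  have hVaR : ∀ Z : Ω → ℝ, Measurable Z →
      VaR μ p (fun ω => bdPosition γ m c r lam (Z ω)) ∈ Set.Icc 0 m := fun Z hZ =>
    ⟨VaR_nonneg (ae_of_all _ fun ω => (bdPosition_mem_Icc hr hlam).1) hp.1,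
      VaR_le_of_ae_le (hgm.comp hZ) hp (ae_of_all _ fun ω => (bdPosition_mem_Icc hr hlam).2)⟩
  have hprob : ∀ A : Set ℝ, μ.map X (frontier A) = 0 → Filter.Tendsto
      (fun Z : M.carrier => |(μ.map Z.1).real A - (μ.map X).real A|)
      (M.neighborhoods ⟨X, hX⟩) (𝓝 0) := by
    intro A hfr
    have h := ProbabilityMeasure.tendsto_measure_of_null_frontier_of_tendsto'
      (hM.tendsto_law ⟨X, hX⟩) (E := A) hfr
    have h' : Filter.Tendsto (fun Z : M.carrier => (μ.map Z.1).real A)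
        (M.neighborhoods ⟨X, hX⟩) (𝓝 ((μ.map X).real A)) :=
      (ENNReal.tendsto_toReal (measure_ne_top ((M.law μ ⟨X, hX⟩ : ProbabilityMeasure ℝ) :
        Measure ℝ) A)).comp h
    simpa using (h'.sub_const ((μ.map X).real A)).abs
  have t1 := hprob {x | c < γ x} (hA.measure_frontier_eq_zero hc (Or.inl le_rfl)
    (Or.inr fun x (hx : γ x < c) (hx' : c < γ x) => lt_asymm hx hx'))
  have t2 := hprob {x | γ x < c} (hA.measure_frontier_eq_zero hc
    (Or.inr fun x (hx : c < γ x) (hx' : γ x < c) => lt_asymm hx hx') (Or.inl le_rfl))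
  have t3 := hprob {x | γ x = c} (hA.measure_frontier_eq_zero hc
    (Or.inr fun x (hx : _ < _) (hx' : _ = _) => ne_of_gt hx hx') (Or.inr fun x (hx : _ < _) (hx' : _ = _) => ne_of_lt hx hx'))
  refine tendsto_ES (S := Set.Icc 0 m) hp (fun Z => hgm.comp (hmeas Z)) (fun Z => hint _ (hmeas Z))
    (hgm.comp hA.measurable_X) (hint _ hA.measurable_X) (fun Z => hVaR _ (hmeas Z))
    (hVaR _ hA.measurable_X) (by simpa using ((t1.add t2).add t3).mul_const m) fun Z t ht => ?_
  rw [integral_excess_bdPosition hγ (hmeas Z), integral_excess_bdPosition hγ hA.measurable_X]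
  have hle : ∀ a, a ≤ m → |max (a - t) 0| ≤ m := by
    intro a ha
    rw [abs_of_nonneg (le_max_right _ _)]
    exact max_le (by linarith [ht.1]) (ht.1.trans ht.2)
  have hterm : ∀ (A : Set ℝ) (a : ℝ), a ≤ m →
      |((μ.map Z.1).real A - (μ.map X).real A) * max (a - t) 0|
        ≤ |(μ.map Z.1).real A - (μ.map X).real A| * m := by
    intro A a ha
    rw [abs_mul]
    exact mul_le_mul_of_nonneg_left (hle a ha) (abs_nonneg _)
  have s1 := hterm {x | c < γ x} m le_rfl
  have s2 := hterm {x | γ x < c} r hr.2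
  have s3 := hterm {x | γ x = c} lam hlam.2
  rw [abs_le] at s1 s2 s3 ⊢
  constructor <;> linarith [s1.1, s1.2, s2.1, s2.2, s3.1, s3.2]

end Positions

/-! ### Optimal positions for the three problems -/

section Optimality

variable {Ω : Type*} [MeasurableSpace Ω] {μ : Measure Ω} {p : ℝ} {X : Ω → ℝ} {γ : ℝ → ℝ}

lemma budgetConstraint_iff {x₀ : ℝ} {g : ℝ → ℝ}
    (h : Integrable (fun ω => γ (X ω) * g (X ω)) μ) :
    BudgetConstraint μ X γ x₀ g ↔ x₀ ≤ ∫ ω, γ (X ω) * g (X ω) ∂μ := by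
  rw [BudgetConstraint, extExpectation_eq_integral h, EReal.coe_le_coe_iff]

lemma GlobalAssumptions.integrable_mul (hA : GlobalAssumptions μ X γ) {U : Ω → ℝ}
    (hU : Integrable (fun ω => γ (X ω) * U ω) μ) {g : ℝ → ℝ} (hg : Measurable g)
    (h : ∀ᵐ ω ∂μ, 0 ≤ g (X ω) ∧ g (X ω) ≤ U ω) :
    Integrable (fun ω => γ (X ω) * g (X ω)) μ :=
  integrable_mul_of_le (hA.measurable_γ.comp hA.measurable_X).aestronglyMeasurable
    (hg.comp hA.measurable_X).aestronglyMeasurable hU (h.mono fun _ => And.left)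
    (h.mono fun _ => And.right)

lemma integrable_of_mem_Icc {Y U : Ω → ℝ} (hY : Measurable Y) (hU : Integrable U μ)
    (h : ∀ᵐ ω ∂μ, 0 ≤ Y ω ∧ Y ω ≤ U ω) : Integrable Y μ := by
  refine Integrable.mono hU hY.aestronglyMeasurable ?_
  filter_upwards [h] with ω hω
  rw [Real.norm_eq_abs, Real.norm_eq_abs, abs_of_nonneg hω.1, abs_of_nonneg (hω.1.trans hω.2)]
  exact hω.2

lemma exists_integral_min_eq (hX : Measurable X) (hXi : Integrable X μ)
    (hX0 : ∀ᵐ ω ∂μ, 0 ≤ X ω) {x₀ : ℝ} (h0 : 0 ≤ x₀) (h1 : x₀ < ∫ ω, X ω ∂μ) :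
    ∃ r, 0 ≤ r ∧ ∫ ω, min (X ω) r ∂μ = x₀ := by
  -- Truncating at `|r|` keeps the domination by `X` valid for all real `r`.
  have hmeas : ∀ r, AEStronglyMeasurable (fun ω => min (X ω) |r|) μ := fun r =>
    (hX.min measurable_const).aestronglyMeasurable
  have hbound : ∀ r, ∀ᵐ ω ∂μ, ‖min (X ω) |r|‖ ≤ ‖X ω‖ := fun r => by
    filter_upwards [hX0] with ω h
    rw [Real.norm_eq_abs, Real.norm_eq_abs, abs_of_nonneg (le_min h (abs_nonneg r)),
      abs_of_nonneg h]
    exact min_le_left _ _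
  have hcont : Continuous fun r : ℝ => ∫ ω, min (X ω) |r| ∂μ :=
    continuous_of_dominated hmeas hbound hXi.norm (ae_of_all _ fun ω => by fun_prop)
  have hlim : Filter.Tendsto (fun r : ℝ => ∫ ω, min (X ω) |r| ∂μ) Filter.atTop
      (𝓝 (∫ ω, X ω ∂μ)) := by
    refine tendsto_integral_filter_of_dominated_convergence (fun ω => ‖X ω‖)
      (Filter.Eventually.of_forall hmeas) (Filter.Eventually.of_forall hbound) hXi.norm
      (ae_of_all _ fun ω => tendsto_const_nhds.congr' ?_)
    filter_upwards [Filter.eventually_ge_atTop (X ω)] with r hr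
    rw [min_eq_left (hr.trans (le_abs_self r))]
  obtain ⟨b, hb, hb0⟩ := ((hlim.eventually_const_lt h1).and (Filter.eventually_ge_atTop 0)).exists
  have hzero : ∫ ω, min (X ω) |0| ∂μ = 0 := by
    refine integral_eq_zero_of_ae (hX0.mono fun ω h => ?_)
    simp [h]
  obtain ⟨r, hr, he⟩ := intermediate_value_Icc hb0 hcont.continuousOn ⟨hzero.le.trans h0, hb.le⟩
  refine ⟨r, hr.1, ?_⟩
  simpa only [abs_of_nonneg hr.1] using he

variable [IsProbabilityMeasure μ]

/-- Since `(y - t)⁺ - y = -min y t`, for `t ≤ r` the claim reduces to `min Y t ≤ min X t = min (min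
X r) t`; for `t ≥ r` the truncated position has no excess. -/
lemma ES_min_le (hp : p ∈ Set.Ioo (0 : ℝ) 1) {Y : Ω → ℝ} (hX : Measurable X)
    (hXi : Integrable X μ) (hY : Measurable Y) (hYi : Integrable Y μ) {r : ℝ}
    (hYX : ∀ᵐ ω ∂μ, Y ω ≤ X ω) (hint : ∫ ω, min (X ω) r ∂μ ≤ ∫ ω, Y ω ∂μ) :
    ES μ p (fun ω => min (X ω) r) ≤ ES μ p Y := by
  have hp' : 0 < 1 - p := sub_pos.2 hp.2
  have hGi : Integrable (fun ω => min (X ω) r) μ := hXi.inf (integrable_const r)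
  have hGm : Measurable fun ω => min (X ω) r := hX.min measurable_const
  rw [ES_eq_ruObjective hY hYi hp]
  set t := VaR μ p Y
  refine (ES_le_ruObjective hGm hGi hp t).trans (EReal.coe_le_coe_iff.2 ?_)
  have key : ∫ ω, max (min (X ω) r - t) 0 ∂μ ≤ ∫ ω, max (Y ω - t) 0 ∂μ := by
    rcases le_total r t with hrt | hrt
    · have : ∀ ω, max (min (X ω) r - t) 0 = 0 := fun ω =>
        max_eq_right (by linarith [min_le_right (X ω) r])
      simp only [this, integral_zero]
      exact integral_nonneg fun _ => le_max_right _ _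
    · have h1 := Integrable.excess hGi t
      have h2 := Integrable.excess hYi t
      have : ∫ ω, (max (min (X ω) r - t) 0 - min (X ω) r) ∂μ
          ≤ ∫ ω, (max (Y ω - t) 0 - Y ω) ∂μ := by
        refine integral_mono_ae (h1.sub hGi) (h2.sub hYi) ?_
        filter_upwards [hYX] with ω h
        rcases le_total (X ω) r with hx | hx
        · simp only [min_eq_left hx]
          rcases le_total (X ω) t with h3 | h3
          · rw [max_eq_right (by linarith)]
            linarith [le_max_right (Y ω - t) 0]
          · rw [max_eq_left (by linarith)]
            linarith [le_max_left (Y ω - t) 0]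
        · simp only [min_eq_right hx]
          rw [max_eq_left (by linarith)]
          linarith [le_max_left (Y ω - t) 0]
      rw [integral_sub h1 hGi, integral_sub h2 hYi] at this
      linarith
  unfold ruObjective
  gcongr

lemma integral_le_ES (hp : p ∈ Set.Ioo (0 : ℝ) 1) {Y : Ω → ℝ} (hY : Measurable Y)
    (hYi : Integrable Y μ) (hY0 : ∀ᵐ ω ∂μ, 0 ≤ Y ω) :
    ((∫ ω, Y ω ∂μ : ℝ) : EReal) ≤ ES μ p Y := by
  have hp' : 0 < 1 - p := sub_pos.2 hp.2
  -- The constant scenario `1 - p` turns the dual bound into the mean.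
  have h := le_ES_of_scenario hY hYi hp hY0 (w := fun _ => 1 - p) measurable_const
    (ae_of_all _ fun _ => hp'.le) (ae_of_all _ fun _ => by linarith [hp.1]) (by simp)
  have e : 1 / (1 - p) * ∫ ω, (1 - p) * Y ω ∂μ = ∫ ω, Y ω ∂μ := by
    rw [integral_const_mul]
    field_simp
  rwa [e] at h

/-- Under E1 the pricing density is a dual density, so the budget itself bounds `ES` from below. -/
lemma isRobustOptimizer_cm_const (hp : p ∈ Set.Ioo (0 : ℝ) 1) (hA : GlobalAssumptions μ X γ)
    (hE : AssumptionE1 μ X γ p) (x₀ : ℝ) {M : ModelSpace Ω ℝ} (hX : X ∈ M.carrier) :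
    IsRobustOptimizer (ES μ p) (cmTriplet μ X γ x₀ M) ⟨X, hX⟩ (fun _ => x₀) := by
  have hγ1 : ∀ᵐ ω ∂μ, γ (X ω) ≤ 1 / (1 - p) := by
    filter_upwards [ae_le_essSup (μ := μ) (f := fun ω => (γ (X ω) : EReal))] with ω h
    exact EReal.coe_le_coe_iff.1 (h.trans hE)
  refine isRobustOptimizer_of_le ⟨measurable_const, ?_⟩ (fun h hh => ?_) tendsto_const_nhds
  · rw [budgetConstraint_iff (hA.integrable_density.mul_const x₀), integral_mul_const,
      hA.integral_γ, one_mul]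
  · rw [ES_const hp]
    exact hh.2.trans (le_ES_of_density_le (hh.1.comp hA.measurable_X) hp hA.integrable_density
      (hA.ae_pos_density.mono fun _ h => h.le) hγ1 hA.integral_γ)

lemma isRobustOptimizer_ns_zero (hp : p ∈ Set.Ioo (0 : ℝ) 1) (hA : GlobalAssumptions μ X γ)
    {M : ModelSpace Ω ℝ} (hX : X ∈ M.carrier) :
    IsRobustOptimizer (ES μ p) (nsTriplet μ X γ 0 M) ⟨X, hX⟩ (fun _ => 0) := by
  refine isRobustOptimizer_of_le ⟨measurable_const, ?_, ?_⟩ (fun h hh => ?_) tendsto_const_nhds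
  · rw [budgetConstraint_iff (by simp)]
    simp
  · exact hA.nonneg_X.mono fun ω h => ⟨le_rfl, h⟩
  · rw [ES_const hp]
    exact ES_nonneg (hh.1.comp hA.measurable_X) hp (hh.2.2.mono fun _ => And.left)

lemma isRobustOptimizer_bd_zero (hp : p ∈ Set.Ioo (0 : ℝ) 1) (hA : GlobalAssumptions μ X γ)
    {m : ℝ} (hm : 0 < m) {M : ModelSpace Ω ℝ} (hX : X ∈ M.carrier) :
    IsRobustOptimizer (ES μ p) (bdTriplet μ X γ 0 m M) ⟨X, hX⟩ (fun _ => 0) := by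
  refine isRobustOptimizer_of_le ⟨measurable_const, ?_, ?_⟩ (fun h hh => ?_) tendsto_const_nhds
  · rw [budgetConstraint_iff (by simp)]
    simp
  · exact ae_of_all _ fun ω => ⟨le_rfl, hm.le⟩
  · rw [ES_const hp]
    exact ES_nonneg (hh.1.comp hA.measurable_X) hp (hh.2.2.mono fun _ => And.left)

lemma exists_isRobustOptimizer_nsPosition (hp : p ∈ Set.Ioo (0 : ℝ) 1)
    (hA : GlobalAssumptions μ X γ) (hE : AssumptionE2 μ X γ) {x₀ : ℝ} (h0 : 0 < x₀)
    (h1 : x₀ < ∫ ω, γ (X ω) * X ω ∂μ) {q : ℝ≥0∞} (hq : 1 ≤ q)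
    (hX : X ∈ (lpModels μ q hq).carrier) :
    ∃ c r lam : ℝ, 0 < c ∧ 0 ≤ r ∧ lam ∈ Set.Icc (0 : ℝ) 1 ∧
      IsRobustOptimizer (ES μ p) (nsTriplet μ X γ x₀ (lpModels μ q hq)) ⟨X, hX⟩
        (nsPosition γ c r lam) := by
  have hXm := hA.measurable_X
  have hXi : Integrable X μ := memLp_one_iff_integrable.1 (hX.2.mono_exponent hq)
  have hlam : (1 : ℝ) ∈ Set.Icc (0 : ℝ) 1 := ⟨zero_le_one, le_rfl⟩
  -- The level set `{γ(X) = c}` is null in both cases of E2, so the weight there is immaterial; the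
  -- value `1` makes the position agree with `hedge`.
  suffices h : ∃ c r : ℝ, 0 < c ∧ 0 ≤ r ∧ (∀ᵐ ω ∂μ, γ (X ω) ≠ c) ∧
      x₀ ≤ ∫ ω, γ (X ω) * nsPosition γ c r 1 (X ω) ∂μ ∧
      ∀ Y : Ω → ℝ, Measurable Y → (∀ᵐ ω ∂μ, 0 ≤ Y ω ∧ Y ω ≤ X ω) →
        x₀ ≤ ∫ ω, γ (X ω) * Y ω ∂μ → ES μ p (fun ω => nsPosition γ c r 1 (X ω)) ≤ ES μ p Y by
    obtain ⟨c, r, hc, hr, hne, hb, hopt⟩ := h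
    have hgm := measurable_nsPosition hA.measurable_γ c r 1
    have hgX : ∀ᵐ ω ∂μ, 0 ≤ nsPosition γ c r 1 (X ω) ∧ nsPosition γ c r 1 (X ω) ≤ X ω :=
      hA.nonneg_X.mono fun ω h => nsPosition_mem_Icc hr hlam h
    refine ⟨c, r, 1, hc, hr, hlam, isRobustOptimizer_of_le ⟨hgm, ?_, hgX⟩ (fun h hh => ?_)
      (hA.tendsto_ES_nsPosition hp hq hX hr hlam hne)⟩
    · exact (budgetConstraint_iff (hA.integrable_mul hA.integrable_γ_mul hgm hgX)).2 hb
    · exact hopt _ (hh.1.comp hXm) hh.2.2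
        ((budgetConstraint_iff (hA.integrable_mul hA.integrable_γ_mul hh.1 hh.2.2)).1 hh.2.1)
  rcases hE with ⟨k, hk⟩ | hE
  · have hone := hA.density_eq_one hk
    have hmul : ∀ Y : Ω → ℝ, ∫ ω, γ (X ω) * Y ω ∂μ = ∫ ω, Y ω ∂μ := fun Y =>
      integral_congr_ae (hone.mono fun ω h => by simp only [h, one_mul])
    rw [hmul] at h1
    obtain ⟨r, hr, hr'⟩ := exists_integral_min_eq hXm hXi hA.nonneg_X h0.le h1
    have hpos : (fun ω => nsPosition γ 2 r 1 (X ω)) =ᵐ[μ] fun ω => min (X ω) r := by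
      filter_upwards [hone] with ω h
      norm_num [nsPosition, h]
    -- Any `c > 1` avoids the single value `1` of `γ(X)` and leaves only the truncated branch.
    refine ⟨2, r, two_pos, hr, hone.mono fun ω h => by norm_num [h], ?_, fun Y hY hYX hYb => ?_⟩
    · rw [hmul, integral_congr_ae hpos, hr']
    · have hm : Measurable fun ω => nsPosition γ 2 r 1 (X ω) :=
        (measurable_nsPosition hA.measurable_γ 2 r 1).comp hXm
      rw [ES_congr_ae hm (hXm.min measurable_const) hpos]
      rw [hmul] at hYb
      exact ES_min_le hp hXm hXi hY (integrable_of_mem_Icc hY hXi hYX)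
        (hYX.mono fun _ => And.right) (hr'.le.trans hYb)
  · have hp' : 0 < 1 - p := sub_pos.2 hp.2
    have hatom : ∀ k, ∀ᵐ ω ∂μ, γ (X ω) ≠ k := fun k => measure_eq_zero_iff_ae_notMem.1 (hE k)
    have hγm : Measurable fun ω => γ (X ω) := hA.measurable_γ.comp hXm
    have hγ0 := hA.ae_pos_density
    have hEX : 0 ≤ ∫ ω, X ω ∂μ := integral_nonneg_of_ae hA.nonneg_X
    -- By Markov's inequality `P(X > R) < 1 - p`, so at `r = R` the scenario mass is too small.
    set R := ((∫ ω, X ω ∂μ) + 1) / (1 - p) with hRdef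
    have hR : 0 < R := by positivity
    have hend : ∀ c, 0 < c → ¬ (1 - p ≤ ∫ ω, scenario (fun ω => γ (X ω)) X c R ω ∂μ ∧
        ∫ ω, γ (X ω) * hedge (fun ω => γ (X ω)) X c R ω ∂μ ≤ x₀) := by
      rintro c hc ⟨h, -⟩
      have hle : ∫ ω, scenario (fun ω => γ (X ω)) X c R ω ∂μ ≤ ∫ ω, X ω / R ∂μ := by
        refine integral_mono_ae (integrable_scenario hγm hXm (hγ0.mono fun _ h => h.le) hc)
          (hXi.div_const R) ?_
        filter_upwards [hA.nonneg_X] with ω hω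
        by_cases hRX : R < X ω
        · exact scenario_le_one.trans ((one_le_div hR).2 hRX.le)
        · rw [scenario, if_neg hRX]
          positivity
      rw [integral_div] at hle
      have : (∫ ω, X ω ∂μ) / R < 1 - p := by
        rw [div_lt_iff₀ hR, hRdef]
        field_simp
        linarith
      linarith
    obtain ⟨c, hc, r, hr, hb, hs⟩ := exists_optimal_hedge hp hγm hXm hγ0 hA.nonneg_X
      hA.integrable_density hA.integral_γ hA.integrable_γ_mul hatom h0 h1 hR.le
      (fun r _ => hA.ae_ne r) hend
    have hpos : (fun ω => nsPosition γ c r 1 (X ω)) = hedge (fun ω => γ (X ω)) X c r := by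
      ext ω
      simp [nsPosition, hedge]
    refine ⟨c, r, hc, hr.1, hatom c, ?_, fun Y hY hYX hYb => ?_⟩
    · simp only [congrFun hpos, hb, le_refl]
    · rw [hpos]
      exact ES_hedge_le hp hγm hXm (hγ0.mono fun _ h => h.le) hA.nonneg_X hXi hA.integrable_γ_mul
        hc hr.1 hs hY (hYX.mono fun _ => And.left) (hYX.mono fun _ => And.right) (hb.le.trans hYb)

lemma exists_isRobustOptimizer_bdPosition (hp : p ∈ Set.Ioo (0 : ℝ) 1)
    (hA : GlobalAssumptions μ X γ) (hE : AssumptionE2 μ X γ) {m x₀ : ℝ} (h0 : 0 < x₀)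
    (h1 : x₀ < m) {M : ModelSpace Ω ℝ} (hM : IsClassicModels μ M) (hX : X ∈ M.carrier) :
    ∃ c r lam : ℝ, 0 < c ∧ r ∈ Set.Icc 0 m ∧ lam ∈ Set.Icc r m ∧
      IsRobustOptimizer (ES μ p) (bdTriplet μ X γ x₀ m M) ⟨X, hX⟩ (bdPosition γ m c r lam) := by
  have hm : 0 < m := h0.trans h1
  have hXm := hA.measurable_X
  have hγU : Integrable (fun ω => γ (X ω) * (fun _ => m) ω) μ := hA.integrable_density.mul_const m
  suffices h : ∃ c r : ℝ, 0 < c ∧ r ∈ Set.Icc 0 m ∧ (∀ᵐ ω ∂μ, γ (X ω) ≠ c) ∧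
      x₀ ≤ ∫ ω, γ (X ω) * bdPosition γ m c r r (X ω) ∂μ ∧
      ∀ Y : Ω → ℝ, Measurable Y → (∀ᵐ ω ∂μ, 0 ≤ Y ω ∧ Y ω ≤ m) →
        x₀ ≤ ∫ ω, γ (X ω) * Y ω ∂μ → ES μ p (fun ω => bdPosition γ m c r r (X ω)) ≤ ES μ p Y by
    obtain ⟨c, r, hc, hr, hne, hb, hopt⟩ := h
    have hlam : r ∈ Set.Icc r m := ⟨le_rfl, hr.2⟩
    have hgm := measurable_bdPosition hA.measurable_γ m c r r
    have hgX : ∀ᵐ ω ∂μ, 0 ≤ bdPosition γ m c r r (X ω) ∧ bdPosition γ m c r r (X ω) ≤ m :=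
      ae_of_all _ fun ω => bdPosition_mem_Icc hr hlam
    refine ⟨c, r, r, hc, hr, hlam, isRobustOptimizer_of_le ⟨hgm, ?_, hgX⟩ (fun h hh => ?_)
      (hA.tendsto_ES_bdPosition hp hM hX hr hlam hne)⟩
    · exact (budgetConstraint_iff (hA.integrable_mul hγU hgm hgX)).2 hb
    · exact hopt _ (hh.1.comp hXm) hh.2.2
        ((budgetConstraint_iff (hA.integrable_mul hγU hh.1 hh.2.2)).1 hh.2.1)
  rcases hE with ⟨k, hk⟩ | hE
  · have hone := hA.density_eq_one hk
    have hmul : ∀ Y : Ω → ℝ, ∫ ω, γ (X ω) * Y ω ∂μ = ∫ ω, Y ω ∂μ := fun Y =>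
      integral_congr_ae (hone.mono fun ω h => by simp only [h, one_mul])
    have hpos : (fun ω => bdPosition γ m 2 x₀ x₀ (X ω)) =ᵐ[μ] fun _ => x₀ := by
      filter_upwards [hone] with ω h
      norm_num [bdPosition, h]
    -- With `γ(X) = 1` the position is the constant `x₀`, optimal because `ES` dominates the mean.
    refine ⟨2, x₀, two_pos, ⟨h0.le, h1.le⟩, hone.mono fun ω h => by norm_num [h], ?_,
      fun Y hY hYm hYb => ?_⟩
    · rw [hmul, integral_congr_ae hpos]
      simp
    · have hgm : Measurable fun ω => bdPosition γ m 2 x₀ x₀ (X ω) :=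
        (measurable_bdPosition hA.measurable_γ m 2 x₀ x₀).comp hXm
      rw [ES_congr_ae hgm measurable_const hpos, ES_const hp]
      rw [hmul] at hYb
      exact (EReal.coe_le_coe_iff.2 hYb).trans (integral_le_ES hp hY
        (integrable_of_mem_Icc hY (integrable_const m) hYm) (hYm.mono fun _ => And.left))
  · have hatom : ∀ k, ∀ᵐ ω ∂μ, γ (X ω) ≠ k := fun k => measure_eq_zero_iff_ae_notMem.1 (hE k)
    have hγm : Measurable fun ω => γ (X ω) := hA.measurable_γ.comp hXm
    have hγ0 := hA.ae_pos_density
    have hγ0' : ∀ᵐ ω ∂μ, 0 ≤ γ (X ω) := hγ0.mono fun _ h => h.le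
    have hU0 : ∀ᵐ ω ∂μ, 0 ≤ (fun _ => m) ω := ae_of_all _ fun _ => hm.le
    -- The midpoint serves as `R`: it exceeds `x₀`, so `r = R` costs too much, and it is below `m`,
    -- so the constant limit `m` never equals an `r` in `[0, R]`.
    have hR : 0 ≤ (x₀ + m) / 2 := by linarith
    have hmass : ∀ v : ℝ, ∫ ω, γ (X ω) * v ∂μ = v := fun v => by
      rw [integral_mul_const, hA.integral_γ, one_mul]
    have hend : ∀ c, 0 < c →
        ¬ (1 - p ≤ ∫ ω, scenario (fun ω => γ (X ω)) (fun _ => m) c ((x₀ + m) / 2) ω ∂μ ∧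
        ∫ ω, γ (X ω) * hedge (fun ω => γ (X ω)) (fun _ => m) c ((x₀ + m) / 2) ω ∂μ ≤ x₀) := by
      rintro c hc ⟨-, h⟩
      have hle : ∫ ω, γ (X ω) * ((x₀ + m) / 2) ∂μ
          ≤ ∫ ω, γ (X ω) * hedge (fun ω => γ (X ω)) (fun _ => m) c ((x₀ + m) / 2) ω ∂μ := by
        refine integral_mono_ae (hA.integrable_density.mul_const _)
          (integrable_mul_hedge hγm measurable_const hU0 hγU c hR) ?_
        filter_upwards [hγ0'] with ω h
        refine mul_le_mul_of_nonneg_left ?_ h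
        unfold hedge
        split_ifs
        · linarith
        · exact le_min (by linarith) le_rfl
      rw [hmass] at hle
      linarith
    obtain ⟨c, hc, r, hr, hb, hs⟩ := exists_optimal_hedge (U := fun _ => m) hp hγm
      measurable_const hγ0 hU0 hA.integrable_density hA.integral_γ hγU hatom h0
      (by rw [hmass]; exact h1) hR
      (fun r hr => ae_of_all _ fun _ => by linarith [hr.2] |> ne_of_gt) hend
    have hrm : r ≤ m := by linarith [hr.2]
    have hpos : (fun ω => bdPosition γ m c r r (X ω))
        = hedge (fun ω => γ (X ω)) (fun _ => m) c r := by
      ext ω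
      simp [bdPosition, hedge, min_eq_right hrm]
    refine ⟨c, r, hc, ⟨hr.1, hrm⟩, hatom c, ?_, fun Y hY hYm hYb => ?_⟩
    · simp only [congrFun hpos, hb, le_refl]
    · rw [hpos]
      exact ES_hedge_le hp hγm measurable_const hγ0' hU0 (integrable_const m) hγU
        hc hr.1 hs hY (hYm.mono fun _ => And.left) (hYm.mono fun _ => And.right) (hb.le.trans hYb)

end Optimality

end RobustOpt

theorem theorem2 {Ω : Type*} [MeasurableSpace Ω] (μ : MeasureTheory.Measure Ω)
    [MeasureTheory.IsProbabilityMeasure μ] (p : ℝ) (hp : p ∈ Set.Ioo (0 : ℝ) 1)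
    (X : Ω → ℝ) (γ : ℝ → ℝ) (hA : RobustOpt.GlobalAssumptions μ X γ) :
    -- complete market
    (RobustOpt.AssumptionE1 μ X γ p →
      ∀ (x₀ : ℝ) (M : RobustOpt.ModelSpace Ω ℝ), RobustOpt.IsClassicModels μ M →
      ∀ hX : X ∈ M.carrier,
        RobustOpt.IsRobustAt (RobustOpt.ES μ p) (RobustOpt.cmTriplet μ X γ x₀ M) ⟨X, hX⟩ ∧
        RobustOpt.IsRobustOptimizer (RobustOpt.ES μ p) (RobustOpt.cmTriplet μ X γ x₀ M) ⟨X, hX⟩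
          (fun _ => x₀)) ∧
    -- no short-selling or over-hedging
    (RobustOpt.AssumptionE2 μ X γ →
      ∀ x₀ : ℝ, 0 ≤ x₀ → x₀ < ∫ ω, γ (X ω) * X ω ∂μ →
      ∀ (q : ENNReal) (hq : 1 ≤ q) (hX : X ∈ (RobustOpt.lpModels μ q hq).carrier),
        RobustOpt.IsRobustAt (RobustOpt.ES μ p)
          (RobustOpt.nsTriplet μ X γ x₀ (RobustOpt.lpModels μ q hq)) ⟨X, hX⟩ ∧
        ((x₀ = 0 ∧ RobustOpt.IsRobustOptimizer (RobustOpt.ES μ p)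
            (RobustOpt.nsTriplet μ X γ x₀ (RobustOpt.lpModels μ q hq)) ⟨X, hX⟩ (fun _ => 0)) ∨
          ∃ c r lam : ℝ, 0 < c ∧ 0 ≤ r ∧ lam ∈ Set.Icc (0 : ℝ) 1 ∧
            RobustOpt.IsRobustOptimizer (RobustOpt.ES μ p)
              (RobustOpt.nsTriplet μ X γ x₀ (RobustOpt.lpModels μ q hq)) ⟨X, hX⟩
              (RobustOpt.nsPosition γ c r lam))) ∧
    -- bounded positions
    (RobustOpt.AssumptionE2 μ X γ →
      ∀ m x₀ : ℝ, 0 < m → 0 ≤ x₀ → x₀ < m →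
      ∀ M : RobustOpt.ModelSpace Ω ℝ, RobustOpt.IsClassicModels μ M →
      ∀ hX : X ∈ M.carrier,
        RobustOpt.IsRobustAt (RobustOpt.ES μ p) (RobustOpt.bdTriplet μ X γ x₀ m M) ⟨X, hX⟩ ∧
        ((x₀ = 0 ∧ RobustOpt.IsRobustOptimizer (RobustOpt.ES μ p)
            (RobustOpt.bdTriplet μ X γ x₀ m M) ⟨X, hX⟩ (fun _ => 0)) ∨
          ∃ c r lam : ℝ, 0 < c ∧ r ∈ Set.Icc 0 m ∧ lam ∈ Set.Icc r m ∧
            RobustOpt.IsRobustOptimizer (RobustOpt.ES μ p)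
              (RobustOpt.bdTriplet μ X γ x₀ m M) ⟨X, hX⟩
              (RobustOpt.bdPosition γ m c r lam))) := by
  refine ⟨fun hE x₀ M hM hX => ?_, fun hE x₀ h0 h1 q hq hX => ?_, fun hE m x₀ hm h0 h1 M hM hX => ?_⟩
  · have h := RobustOpt.isRobustOptimizer_cm_const hp hA hE x₀ hX
    exact ⟨⟨RobustOpt.isCompatible_ES hp hM, _, h⟩, h⟩
  · have hcompat := RobustOpt.isCompatible_ES hp
      (T := RobustOpt.nsTriplet μ X γ x₀ (RobustOpt.lpModels μ q hq)) (Or.inl ⟨q, hq, rfl⟩)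
    rcases h0.eq_or_lt with rfl | h0
    · have h := RobustOpt.isRobustOptimizer_ns_zero hp hA hX
      exact ⟨⟨hcompat, _, h⟩, Or.inl ⟨rfl, h⟩⟩
    · obtain ⟨c, r, lam, hc, hr, hlam, h⟩ :=
        RobustOpt.exists_isRobustOptimizer_nsPosition hp hA hE h0 h1 hq hX
      exact ⟨⟨hcompat, _, h⟩, Or.inr ⟨c, r, lam, hc, hr, hlam, h⟩⟩
  · have hcompat := RobustOpt.isCompatible_ES hp
      (T := RobustOpt.bdTriplet μ X γ x₀ m M) hM
    rcases h0.eq_or_lt with rfl | h0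
    · have h := RobustOpt.isRobustOptimizer_bd_zero hp hA hm hX
      exact ⟨⟨hcompat, _, h⟩, Or.inl ⟨rfl, h⟩⟩
    · obtain ⟨c, r, lam, hc, hr, hlam, h⟩ :=
        RobustOpt.exists_isRobustOptimizer_bdPosition hp hA hE h0 h1 hM hX
      exact ⟨⟨hcompat, _, h⟩, Or.inr ⟨c, r, lam, hc, hr, hlam, h⟩⟩
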